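/- Let $\mathbf D$ be a non-singular real $n\times n$ matrix, $h_1,\dots,h_n>0$ and $\sigma>0$. For $\eta>0$ and $\mu\in\mathbb R$ let $\mathbf\Lambda=(\Lambda_1,\dots,\Lambda_n)$ have independent components, each of which is NIG or GAL noise, that is, $$\Lambda_i\mid V_i\sim N\!\left(\tfrac{\sigma}{\sqrt{1+\eta\mu^2}}\,\mu\,(V_i-h_i),\ \tfrac{\sigma^2}{1+\eta\mu^2}V_i\right),$$ where $V_i$ is inverse Gaussian with mean $h_i$ and shape parameter $h_i^2/\eta$ (NIG noise), or gamma with shape $h_i/\eta$ and rate $1/\eta$ (GAL noise). Let $\pi(\mathbf x\mid\eta,\mu)$ be the law of the random vector $\mathbf x$ determined by $\mathbf D\mathbf x\overset{d}{=}\mathbf\Lambda$, and let $\pi^B$ be the law of the base Gaussian model ($\eta=0$, $\mu=0$), $\mathbf D\mathbf x^B\overset{d}{=}\mathbf Z$, with independent $Z_i\sim N(0,\sigma^2h_i)$. Then the Kullback–Leibler divergence $\mathrm{KLD}(\pi(\mathbf x\mid\eta,\mu=0)\,\|\,\pi^B)$ is finite for all sufficiently small $\eta>0$, and, as $\eta\to0^+$,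 $$\mathrm{KLD}\big(\pi(\mathbf x\mid\eta,\mu=0)\,\big\|\,\pi^B\big)=\frac{3}{16}\left(\sum_{i=1}^n\frac1{h_i^2}\right)\eta^2-\frac{9}{16}\left(\sum_{i=1}^n\frac1{h_i^3}\right)\eta^3+\mathcal O(\eta^4).$$ -/

import Mathlib

open Filter Topology Asymptotics MeasureTheory ProbabilityTheory

namespace NoiseModel

/-- The two families of driving noise: normal inverse Gaussian and generalized asymmetric
Laplace. -/
inductive NoiseKind where
  | nig : NoiseKind
  | gal : NoiseKind

/-- Density of the inverse Gaussian distribution with mean `m` and shape `lam`. -/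
noncomputable def inverseGaussianPDFReal (m lam x : ℝ) : ℝ :=
  if 0 < x then
    Real.sqrt (lam / (2 * Real.pi * x ^ 3)) *
      Real.exp (-(lam * (x - m) ^ 2) / (2 * m ^ 2 * x))
  else 0

/-- The inverse Gaussian distribution with mean `m` and shape `lam`. -/
noncomputable def inverseGaussianMeasure (m lam : ℝ) : Measure ℝ :=
  volume.withDensity fun x => ENNReal.ofReal (inverseGaussianPDFReal m lam x)

/-- Law of the mixing variable `V`: inverse Gaussian with mean `h` and shape `h ^ 2 / η` for NIG
noise, gamma with shape `h / η` and rate `1 / η` for GAL noise. In both cases `V` has mean `h` and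
variance `h * η`. Meaningful for `0 < η` and `0 < h`. -/
noncomputable def mixingMeasure (k : NoiseKind) (η h : ℝ) : Measure ℝ :=
  match k with
  | NoiseKind.nig => inverseGaussianMeasure h (h ^ 2 / η)
  | NoiseKind.gal => gammaMeasure (h / η) (1 / η)

/-- Law of a single noise variable `Λ` with parameters `σ, η, μ` and increment length `h`: given the
mixing variable `V = v`, the noise is Gaussian with mean `σ / √(1 + η μ²) * μ * (v - h)` and
variance `σ² / (1 + η μ²) * v`. -/
noncomputable def noiseMeasure (k : NoiseKind) (σ η μ h : ℝ) : Measure ℝ :=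
  (mixingMeasure k η h).bind fun v =>
    gaussianReal (σ / Real.sqrt (1 + η * μ ^ 2) * μ * (v - h))
      (Real.toNNReal (σ ^ 2 / (1 + η * μ ^ 2) * v))

/-- Law of the noise vector `Λ = (Λ₁, …, Λₙ)` with independent components. -/
noncomputable def noiseVectorMeasure {n : ℕ} (k : Fin n → NoiseKind) (σ η μ : ℝ)
    (h : Fin n → ℝ) : Measure (Fin n → ℝ) :=
  Measure.pi fun i => noiseMeasure (k i) σ η μ (h i)

/-- Law of the Gaussian noise vector `Z` with independent components `Zᵢ ∼ N(0, σ² hᵢ)`; this is the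
noise of the base model `η = 0`. -/
noncomputable def gaussianVectorMeasure {n : ℕ} (σ : ℝ) (h : Fin n → ℝ) :
    Measure (Fin n → ℝ) :=
  Measure.pi fun i => gaussianReal 0 (Real.toNNReal (σ ^ 2 * h i))

/-- `P` is the law of a random vector `x` for which `D x` has the law `ν`. -/
def IsSolutionLaw {n : ℕ} (D : Matrix (Fin n) (Fin n) ℝ) (ν P : Measure (Fin n → ℝ)) : Prop :=
  P.map (fun x => D.mulVec x) = ν

end NoiseModel

/-! The matrix `D` is invertible, so the divergence between the laws of `x` equals the divergence
between the noise vectors, and by independence this is a sum over components. For `μ = 0`, dividing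
the `i`-th component by `σ√h` turns it into `√W * Y` with `W = V / h` of mean `1` and variance `ε =
η / h`, and turns its Gaussian counterpart into `Y`, standard normal. It is enough to expand one
scalar divergence in `ε` with an `O(ε⁴)` error and put `ε = η / hᵢ`.

Let `r(x) = E[W^(-1/2) exp(x²/2 (1 - 1/W))]` be the density of `√W * Y` with respect to the standard
Gaussian. Taylor expansion at `W = 1` gives `r = 1 + g + k`, where `g = ε/8 He₄(x)` comes from the
variance of `W` and `k` is `O(ε²)` up to polynomial factors. Since `klFun (1 + u) = u²/2 - u³/6 +
O(u⁴)`, the integrand is `g²/2 + g k - g³/6` up to `O(ε⁴)`.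

The cross term `g k` looks as if it needed the `ε²` part of `k`, hence higher moments of `W`. It
does not: `∫ g k = ∫ g (r - 1 - g)`, and `E He₄(√W Y) = 3 E W² - 6 E W + 3 = 3ε`, while `∫ He₄ = 0`
and `∫ He₄² = 24`, so `∫ g k = 0` exactly. What is left is `24 ε²/128 - 1728 ε³/3072 = 3/16 ε² -
9/16 ε³`, which depends only on the mean and variance of `W`; this is why NIG and GAL agree to this
order.

The Taylor bound on `k` is valid only where `ε x⁴ ≤ 1`. Elsewhere `1 ≤ ε⁴ (1 + x²)⁸`, so crude
polynomial bounds already integrate to `O(ε⁴)`. All that is used about `W` is collected in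
`IsConcentratedAtOne`; `klDiv_varianceMixture` is the resulting scalar expansion, and both mixing
families are shown to satisfy the conditions with one common constant. -/

namespace InformationTheory

/-! ### Divergence under measurable equivalences and products. -/

lemma klDiv_map_measurableEquiv {α β : Type*} [MeasurableSpace α] [MeasurableSpace β]
    (μ ν : Measure α) [IsFiniteMeasure μ] [IsFiniteMeasure ν] (e : α ≃ᵐ β) :
    klDiv (μ.map e) (ν.map e) = klDiv μ ν := by
  refine le_antisymm (klDiv_map_le μ ν e.measurable) ?_
  have h := klDiv_map_le (μ.map e) (ν.map e) e.symm.measurable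
  simpa [Measure.map_map e.symm.measurable e.measurable] using h

/-- The chain rule leaves the divergence between `μ.prod μ'` and `μ.prod ν'`. Swapping the factors
makes the shared `μ` a common constant kernel, which contributes nothing. -/
lemma klDiv_prod {α β : Type*} [MeasurableSpace α] [MeasurableSpace β]
    (μ ν : Measure α) (μ' ν' : Measure β) [IsProbabilityMeasure μ] [IsProbabilityMeasure ν]
    [IsProbabilityMeasure μ'] [IsProbabilityMeasure ν'] :
    klDiv (μ.prod μ') (ν.prod ν') = klDiv μ ν + klDiv μ' ν' := by
  have h1 := klDiv_compProd_eq_add μ ν (Kernel.const α μ') (Kernel.const α ν')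
  have h2 := klDiv_map_measurableEquiv (μ.prod μ') (μ.prod ν') MeasurableEquiv.prodComm
  have h3 := klDiv_compProd_left μ' ν' (Kernel.const β μ)
  simp only [Measure.compProd_const] at h1 h3
  have e1 : (μ.prod μ').map (MeasurableEquiv.prodComm : α × β ≃ᵐ β × α) = μ'.prod μ :=
    Measure.prod_swap
  have e2 : (μ.prod ν').map (MeasurableEquiv.prodComm : α × β ≃ᵐ β × α) = ν'.prod μ :=
    Measure.prod_swap
  rw [e1, e2] at h2
  rw [h1, ← h2, h3]

lemma klDiv_pi : ∀ {n : ℕ} (μ ν : Fin n → Measure ℝ) [∀ i, IsProbabilityMeasure (μ i)]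
    [∀ i, IsProbabilityMeasure (ν i)],
    klDiv (Measure.pi μ) (Measure.pi ν) = ∑ i, klDiv (μ i) (ν i)
  | 0, μ, ν, _, _ => by
    rw [Measure.pi_of_empty μ 0, Measure.pi_of_empty ν 0]
    simp
  | n + 1, μ, ν, _, _ => by
    have hμ := measurePreserving_piFinSuccAbove μ 0
    have hν := measurePreserving_piFinSuccAbove ν 0
    rw [← klDiv_map_measurableEquiv _ _ (MeasurableEquiv.piFinSuccAbove (fun _ => ℝ) 0),
      hμ.map_eq, hν.map_eq, klDiv_prod, klDiv_pi, Fin.sum_univ_succ]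
    simp

end InformationTheory

/-! ### Removing the matrix `D`. -/

namespace NoiseModel

lemma IsSolutionLaw.klDiv_eq {n : ℕ} {D : Matrix (Fin n) (Fin n) ℝ} (hD : D.det ≠ 0)
    {ν ν' P P' : Measure (Fin n → ℝ)} [IsProbabilityMeasure ν] [IsProbabilityMeasure ν']
    (h : IsSolutionLaw D ν P) (h' : IsSolutionLaw D ν' P') :
    InformationTheory.klDiv P P' = InformationTheory.klDiv ν ν' := by
  have hm : Measurable fun x : Fin n → ℝ => D.mulVec x :=
    (Continuous.matrix_mulVec continuous_const continuous_id).measurable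
  have hm' : Measurable fun x : Fin n → ℝ => D⁻¹.mulVec x :=
    (Continuous.matrix_mulVec continuous_const continuous_id).measurable
  have hu : IsUnit D.det := isUnit_iff_ne_zero.mpr hD
  let e : (Fin n → ℝ) ≃ᵐ (Fin n → ℝ) :=
    { toFun := fun x => D.mulVec x
      invFun := fun x => D⁻¹.mulVec x
      left_inv := fun x => by simp [Matrix.nonsing_inv_mul D hu]
      right_inv := fun x => by simp [Matrix.mul_nonsing_inv D hu]
      measurable_toFun := hm
      measurable_invFun := hm' }
  have he : P.map e = ν := h
  have he' : P'.map e = ν' := h'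
  -- `P` is not assumed finite; its total mass is that of its image `ν`, which is `1`.
  have : IsFiniteMeasure P := by
    refine ⟨?_⟩
    have : P.map e Set.univ = 1 := by rw [he]; exact measure_univ
    rw [e.map_apply] at this
    simp only [Set.preimage_univ] at this
    simp [this]
  have : IsFiniteMeasure P' := by
    refine ⟨?_⟩
    have : P'.map e Set.univ = 1 := by rw [he']; exact measure_univ
    rw [e.map_apply] at this
    simp only [Set.preimage_univ] at this
    simp [this]
  rw [← InformationTheory.klDiv_map_measurableEquiv P P' e, he, he']

/-! ### Gaussian variance mixtures, rescaling and densities. -/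

/-- The Gaussian variance mixture: the law of `√W * Y` with `W ∼ μ` and `Y ∼ N(0, 1)`
independent. -/
noncomputable def varianceMixture (μ : Measure ℝ) : Measure ℝ :=
  μ.bind fun w => gaussianReal 0 w.toNNReal

/-- The functions `w ↦ w ^ (-(j + 1 / 2)) * exp (q * (1 - 1 / w))`, a family closed under
differentiation up to linear combinations. For `j = 0` and `q = x ^ 2 / 2` this is the
ratio at `x` of the densities of `N(0, w)` and `N(0, 1)`. -/
noncomputable def powExpKernel (j q w : ℝ) : ℝ :=
  Real.exp (-(j + 1 / 2) * Real.log w + q * (1 - w⁻¹))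

/-- The density of `varianceMixture μ` with respect to the standard Gaussian measure. -/
noncomputable def mixtureDensity (μ : Measure ℝ) (x : ℝ) : ℝ :=
  ∫ w, powExpKernel 0 (x ^ 2 / 2) w ∂μ

lemma measurable_gaussianReal_toNNReal :
    Measurable fun w : ℝ => gaussianReal 0 w.toNNReal := by
  have h : Measurable fun w : ℝ => ((0 : ℝ), w.toNNReal) := by fun_prop
  exact measurable_gaussianReal.comp h

lemma measurable_powExpKernel :
    Measurable fun p : ℝ × ℝ => powExpKernel 0 (p.2 ^ 2 / 2) p.1 := by
  unfold powExpKernel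
  fun_prop

lemma measurable_powExpKernel_right (j q : ℝ) : Measurable (powExpKernel j q) := by
  unfold powExpKernel
  fun_prop

lemma powExpKernel_pos (j q w : ℝ) : 0 < powExpKernel j q w := Real.exp_pos _

lemma gaussianReal_map_mul_of_var (c w : ℝ) :
    (gaussianReal 0 w.toNNReal).map (c * ·) = gaussianReal 0 (c ^ 2 * w).toNNReal := by
  rw [gaussianReal_map_const_mul, mul_zero]
  congr 1
  rw [Real.toNNReal_mul (sq_nonneg c), Real.toNNReal_of_nonneg (sq_nonneg c)]

lemma varianceMixture_eq_map (μ : Measure ℝ) [IsProbabilityMeasure μ] (hμ : ∀ᵐ w ∂μ, 0 < w) :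
    varianceMixture μ = (μ.prod (gaussianReal 0 1)).map fun p => √p.1 * p.2 := by
  have hm : Measurable fun p : ℝ × ℝ => √p.1 * p.2 := by fun_prop
  ext s hs
  rw [varianceMixture, Measure.bind_apply hs measurable_gaussianReal_toNNReal.aemeasurable,
    Measure.map_apply hm hs, Measure.prod_apply (hm hs)]
  refine lintegral_congr_ae ?_
  filter_upwards [hμ] with w hw
  have h := gaussianReal_map_mul_of_var (√w) 1
  rw [Real.sq_sqrt hw.le, mul_one, Real.toNNReal_one] at h
  rw [← h, Measure.map_apply (by fun_prop) hs]
  rfl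

instance isProbabilityMeasure_varianceMixture (μ : Measure ℝ) [IsProbabilityMeasure μ] :
    IsProbabilityMeasure (varianceMixture μ) := by
  refine ⟨?_⟩
  rw [varianceMixture,
    Measure.bind_apply MeasurableSet.univ measurable_gaussianReal_toNNReal.aemeasurable]
  simp

/-- Conditionally on `V = v`, `N(0, σ² v)` is the image of `N(0, v / h)` under multiplication by
`σ√h`, the same factor that produces the base Gaussian. Hence `σ` disappears from the divergence and
`h` survives only through the law of `V / h`. -/
lemma noiseMeasure_zero_eq_map (k : NoiseKind) (σ η : ℝ) {h : ℝ} (hh : 0 < h) :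
    noiseMeasure k σ η 0 h =
      (varianceMixture ((mixingMeasure k η h).map fun v => v / h)).map (σ * √h * ·) := by
  have hc : Measurable fun x : ℝ => σ * √h * x := by fun_prop
  have hg : Measurable fun v : ℝ => gaussianReal 0 (σ ^ 2 * v).toNNReal :=
    measurable_gaussianReal_toNNReal.comp (measurable_const_mul (σ ^ 2))
  ext s hs
  have hms : Measurable fun w : ℝ => gaussianReal 0 w.toNNReal ((σ * √h * ·) ⁻¹' s) :=
    (Measure.measurable_coe (hc hs)).comp measurable_gaussianReal_toNNReal
  rw [Measure.map_apply hc hs, varianceMixture,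
    Measure.bind_apply (hc hs) measurable_gaussianReal_toNNReal.aemeasurable,
    lintegral_map hms (by fun_prop), noiseMeasure]
  simp only [mul_zero, zero_mul, ne_eq, OfNat.ofNat_ne_zero, not_false_eq_true, zero_pow,
    add_zero, div_one]
  rw [Measure.bind_apply hs hg.aemeasurable]
  refine lintegral_congr fun v => ?_
  have hv := gaussianReal_map_mul_of_var (σ * √h) (v / h)
  have e : (σ * √h) ^ 2 * (v / h) = σ ^ 2 * v := by
    rw [mul_pow, Real.sq_sqrt hh.le]; field_simp
  rw [e] at hv
  rw [← hv, Measure.map_apply hc hs]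

lemma gaussianReal_eq_map (σ : ℝ) {h : ℝ} (hh : 0 < h) :
    gaussianReal 0 (σ ^ 2 * h).toNNReal = (gaussianReal 0 1).map (σ * √h * ·) := by
  have h' := gaussianReal_map_mul_of_var (σ * √h) 1
  rw [Real.toNNReal_one, mul_pow, Real.sq_sqrt hh.le, mul_one] at h'
  exact h'.symm

lemma klDiv_noiseMeasure (k : NoiseKind) {σ η h : ℝ} (hσ : 0 < σ) (hh : 0 < h)
    [IsProbabilityMeasure (mixingMeasure k η h)] :
    InformationTheory.klDiv (noiseMeasure k σ η 0 h) (gaussianReal 0 (σ ^ 2 * h).toNNReal) =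
      InformationTheory.klDiv (varianceMixture ((mixingMeasure k η h).map fun v => v / h))
        (gaussianReal 0 1) := by
  have : IsProbabilityMeasure ((mixingMeasure k η h).map fun v => v / h) :=
    Measure.isProbabilityMeasure_map (by fun_prop)
  have hne : σ * √h ≠ 0 := by positivity
  rw [noiseMeasure_zero_eq_map k σ η hh, gaussianReal_eq_map σ hh]
  exact InformationTheory.klDiv_map_measurableEquiv _ _
    (Homeomorph.mulLeft₀ (σ * √h) hne).toMeasurableEquiv

lemma gaussianPDFReal_eq_mul_powExpKernel {w : ℝ} (hw : 0 < w) (x : ℝ) :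
    gaussianPDFReal 0 w.toNNReal x = gaussianPDFReal 0 1 x * powExpKernel 0 (x ^ 2 / 2) w := by
  have h1 : Real.exp (-(1 / 2) * Real.log w) = (√w)⁻¹ := by
    rw [neg_mul, Real.exp_neg, Real.sqrt_eq_rpow, Real.rpow_def_of_pos hw, mul_comm]
  simp only [gaussianPDFReal, powExpKernel, zero_add, Real.coe_toNNReal w hw.le, Real.exp_add, h1,
    sub_zero, NNReal.coe_one, mul_one]
  rw [Real.sqrt_mul (by positivity), mul_inv]
  have h2 : Real.exp (-x ^ 2 / (2 * w)) =
      Real.exp (-x ^ 2 / 2) * Real.exp (x ^ 2 / 2 * (1 - w⁻¹)) := by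
    rw [← Real.exp_add]; congr 1; field_simp; ring
  rw [h2]; ring

/-- Tonelli applied to the densities of `N(0, w)`; positivity of `w` excludes the degenerate
Gaussian. -/
lemma varianceMixture_eq_withDensity (μ : Measure ℝ) [IsProbabilityMeasure μ]
    (hμ : ∀ᵐ w ∂μ, 0 < w) (hint : ∀ x : ℝ, Integrable (powExpKernel 0 (x ^ 2 / 2)) μ) :
    varianceMixture μ =
      (gaussianReal 0 1).withDensity fun x => ENNReal.ofReal (mixtureDensity μ x) := by
  ext s hs
  rw [varianceMixture, Measure.bind_apply hs measurable_gaussianReal_toNNReal.aemeasurable,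
    withDensity_apply _ hs]
  have h1 : ∀ᵐ w ∂μ, gaussianReal 0 w.toNNReal s =
      ∫⁻ x in s, ENNReal.ofReal (powExpKernel 0 (x ^ 2 / 2) w) ∂(gaussianReal 0 1) := by
    filter_upwards [hμ] with w hw
    have hw' : w.toNNReal ≠ 0 := by simpa using hw
    have hm : Measurable fun x : ℝ => ENNReal.ofReal (powExpKernel 0 (x ^ 2 / 2) w) :=
      (measurable_powExpKernel.comp
        (by fun_prop : Measurable fun x : ℝ => (w, x))).ennreal_ofReal
    rw [gaussianReal_of_var_ne_zero 0 hw', gaussianReal_of_var_ne_zero 0 one_ne_zero,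
      withDensity_apply _ hs, restrict_withDensity hs,
      lintegral_withDensity_eq_lintegral_mul _ (measurable_gaussianPDF 0 1)
        hm]
    refine lintegral_congr fun x => ?_
    simp only [Pi.mul_apply, gaussianPDF, gaussianPDFReal_eq_mul_powExpKernel hw,
      ENNReal.ofReal_mul (gaussianPDFReal_nonneg 0 1 x)]
  rw [lintegral_congr_ae h1, lintegral_lintegral_swap]
  · refine lintegral_congr fun x => ?_
    rw [mixtureDensity, ofReal_integral_eq_lintegral_ofReal (hint x)
      (ae_of_all _ fun w => (powExpKernel_pos _ _ _).le)]
  · exact measurable_powExpKernel.ennreal_ofReal.aemeasurable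

/-! ### Cubic expansion of `klFun` at `1`. -/

lemma log_one_add_le_cubic {g : ℝ} (hg : -1 < g) :
    Real.log (1 + g) ≤ g - g ^ 2 / 2 + g ^ 3 / 3 := by
  let f : ℝ → ℝ := fun u => u - u ^ 2 / 2 + u ^ 3 / 3 - Real.log (1 + u)
  -- The derivative has the sign of `u`, so `f` is minimal at `0`, where it vanishes.
  have hf : ∀ u : ℝ, -1 < u → HasDerivAt f (u ^ 3 / (1 + u)) u := by
    intro u hu
    have hu' : 1 + u ≠ 0 := by linarith
    have h := ((((hasDerivAt_id u).sub (((hasDerivAt_id u).pow 2).div_const 2)).add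
      (((hasDerivAt_id u).pow 3).div_const 3)).sub
      (((hasDerivAt_id u).const_add 1).log hu'))
    convert! h using 1
    simp only [id]
    field_simp
    ring
  suffices h : 0 ≤ f g by simp only [f] at h; linarith
  have h0 : f 0 = 0 := by simp [f]
  rcases le_total g 0 with hg0 | hg0
  · have h : AntitoneOn f (Set.Icc g 0) := by
      refine antitoneOn_of_deriv_nonpos (convex_Icc _ _)
        (fun u hu => (hf u (by linarith [hu.1])).continuousAt.continuousWithinAt) ?_ ?_
      · intro u hu
        rw [interior_Icc] at hu
        exact (hf u (by linarith [hu.1])).differentiableAt.differentiableWithinAt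
      · intro u hu
        rw [interior_Icc] at hu
        rw [(hf u (by linarith [hu.1])).deriv]
        exact div_nonpos_of_nonpos_of_nonneg (by nlinarith [hu.2, sq_nonneg u])
          (by linarith [hu.1])
    exact h0 ▸ h (Set.left_mem_Icc.mpr hg0) (Set.right_mem_Icc.mpr hg0) hg0
  · have h : MonotoneOn f (Set.Icc 0 g) := by
      refine monotoneOn_of_deriv_nonneg (convex_Icc _ _)
        (fun u hu => (hf u (by linarith [hu.1])).continuousAt.continuousWithinAt) ?_ ?_
      · intro u hu
        rw [interior_Icc] at hu
        exact (hf u (by linarith [hu.1])).differentiableAt.differentiableWithinAt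
      · intro u hu
        rw [interior_Icc] at hu
        rw [(hf u (by linarith [hu.1])).deriv]
        have := hu.1
        positivity
    exact h0 ▸ h (Set.left_mem_Icc.mpr hg0) (Set.right_mem_Icc.mpr hg0) hg0

lemma abs_klFun_one_add_sub_le {g : ℝ} (hg : -1 ≤ g) :
    |InformationTheory.klFun (1 + g) - (g ^ 2 / 2 - g ^ 3 / 6)| ≤ 16 * g ^ 4 := by
  have hnn := InformationTheory.klFun_nonneg (by linarith : 0 ≤ 1 + g)
  rw [abs_le]
  constructor
  -- For `g ≤ -1/2` nonnegativity of `klFun` is enough, because `g²/2 - g³/6 ≤ 1 ≤ 16 g⁴`. Otherwise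
  -- a lower bound on `log (1 + g)` is needed; it is the cubic upper bound at `-g / (1 + g)`, since
  -- `1 - g / (1 + g)` is the inverse of `1 + g`.
  · rcases le_total g (-1 / 2) with h | h
    · have h2 : (1 / 4 : ℝ) ≤ g ^ 2 := by nlinarith
      have h3 : g ^ 2 ≤ 1 := by nlinarith
      have h4 : -g ^ 3 ≤ 1 := by nlinarith
      nlinarith
    · have h1 : 0 < 1 + g := by linarith
      have hlog := log_one_add_le_cubic (g := -g / (1 + g))
        (by rw [lt_div_iff₀ h1]; linarith)
      have e : 1 + -g / (1 + g) = (1 + g)⁻¹ := by field_simp; ring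
      rw [e, Real.log_inv] at hlog
      rw [InformationTheory.klFun_apply]
      have h5 : (1 + g) * (g / (1 + g) + g ^ 2 / (2 * (1 + g) ^ 2) + g ^ 3 / (3 * (1 + g) ^ 3))
          ≤ (1 + g) * Real.log (1 + g) := by
        refine mul_le_mul_of_nonneg_left ?_ h1.le
        have : -g / (1 + g) - (-g / (1 + g)) ^ 2 / 2 + (-g / (1 + g)) ^ 3 / 3 =
            -(g / (1 + g) + g ^ 2 / (2 * (1 + g) ^ 2) + g ^ 3 / (3 * (1 + g) ^ 3)) := by
          field_simp; ring
        linarith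
      have h6 : (1 + g) * (g / (1 + g) + g ^ 2 / (2 * (1 + g) ^ 2) + g ^ 3 / (3 * (1 + g) ^ 3))
          - g - (g ^ 2 / 2 - g ^ 3 / 6) = g ^ 4 * ((g - 1) / (6 * (1 + g) ^ 2)) := by
        field_simp; ring
      have h7 : -1 ≤ (g - 1) / (6 * (1 + g) ^ 2) := by
        rw [le_div_iff₀ (by positivity)]
        nlinarith
      have h8 : g ^ 4 * (-1) ≤ g ^ 4 * ((g - 1) / (6 * (1 + g) ^ 2)) :=
        mul_le_mul_of_nonneg_left h7 (by positivity)
      have h9 : 0 ≤ g ^ 4 := by positivity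
      linarith
  · rw [InformationTheory.klFun_apply]
    rcases hg.eq_or_lt with rfl | hg'
    · norm_num
    · have h1 := mul_le_mul_of_nonneg_left (log_one_add_le_cubic hg') (by linarith : 0 ≤ 1 + g)
      have h9 : 0 ≤ g ^ 4 := by positivity
      nlinarith

/-! ### Taylor expansion of the density kernel in the mixing variable. -/

lemma abs_le_of_hasDerivAt_of_abs_le {g g' : ℝ → ℝ} {a w B : ℝ} (h0 : g a = 0)
    (hd : ∀ ξ ∈ Set.uIcc a w, HasDerivAt g (g' ξ) ξ) (hB : ∀ ξ ∈ Set.uIcc a w, |g' ξ| ≤ B) :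
    ∀ ξ ∈ Set.uIcc a w, |g ξ| ≤ B * |w - a| := by
  intro ξ hξ
  have h := (convex_uIcc a w).norm_image_sub_le_of_norm_hasDerivWithin_le
    (fun x hx => (hd x hx).hasDerivWithinAt) hB Set.left_mem_uIcc hξ
  rw [h0, sub_zero] at h
  refine h.trans (mul_le_mul_of_nonneg_left (Set.abs_sub_left_of_mem_uIcc hξ) ?_)
  exact (abs_nonneg _).trans (hB a Set.left_mem_uIcc)

/-- The mean value inequality is applied to `f₃`, `f₂`, `f₁`, `f₀` in turn, each with its Taylor
polynomial removed. This loses the factor `1 / 24`, which is harmless. -/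
lemma abs_sub_cubic_taylor_le {f₀ f₁ f₂ f₃ f₄ : ℝ → ℝ} {a w M : ℝ}
    (h₀ : ∀ ξ ∈ Set.uIcc a w, HasDerivAt f₀ (f₁ ξ) ξ)
    (h₁ : ∀ ξ ∈ Set.uIcc a w, HasDerivAt f₁ (f₂ ξ) ξ)
    (h₂ : ∀ ξ ∈ Set.uIcc a w, HasDerivAt f₂ (f₃ ξ) ξ)
    (h₃ : ∀ ξ ∈ Set.uIcc a w, HasDerivAt f₃ (f₄ ξ) ξ)
    (hM : ∀ ξ ∈ Set.uIcc a w, |f₄ ξ| ≤ M) :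
    |f₀ w - (f₀ a + f₁ a * (w - a) + f₂ a / 2 * (w - a) ^ 2 + f₃ a / 6 * (w - a) ^ 3)|
      ≤ M * (w - a) ^ 4 := by
  have b₃ := abs_le_of_hasDerivAt_of_abs_le (g := fun ξ => f₃ ξ - f₃ a) (g' := f₄) (sub_self _)
    (fun ξ hξ => (h₃ ξ hξ).sub_const _) hM
  have b₂ := abs_le_of_hasDerivAt_of_abs_le (g := fun ξ => f₂ ξ - f₂ a - f₃ a * (ξ - a))
    (g' := fun ξ => f₃ ξ - f₃ a) (by simp)
    (fun ξ hξ => by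
      have h := ((h₂ ξ hξ).sub_const (f₂ a)).sub
        (((hasDerivAt_id ξ).sub_const a).const_mul (f₃ a))
      convert! h using 1; ring) b₃
  have b₁ := abs_le_of_hasDerivAt_of_abs_le
    (g := fun ξ => f₁ ξ - f₁ a - f₂ a * (ξ - a) - f₃ a / 2 * (ξ - a) ^ 2)
    (g' := fun ξ => f₂ ξ - f₂ a - f₃ a * (ξ - a)) (by simp)
    (fun ξ hξ => by
      have h := (((h₁ ξ hξ).sub_const (f₁ a)).sub
        (((hasDerivAt_id ξ).sub_const a).const_mul (f₂ a))).sub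
        ((((hasDerivAt_id ξ).sub_const a).pow 2).const_mul (f₃ a / 2))
      convert! h using 1; simp; ring) b₂
  have b₀ := abs_le_of_hasDerivAt_of_abs_le
    (g := fun ξ => f₀ ξ - f₀ a - f₁ a * (ξ - a) - f₂ a / 2 * (ξ - a) ^ 2
      - f₃ a / 6 * (ξ - a) ^ 3)
    (g' := fun ξ => f₁ ξ - f₁ a - f₂ a * (ξ - a) - f₃ a / 2 * (ξ - a) ^ 2) (by simp)
    (fun ξ hξ => by
      have h := ((((h₀ ξ hξ).sub_const (f₀ a)).sub
        (((hasDerivAt_id ξ).sub_const a).const_mul (f₁ a))).sub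
        ((((hasDerivAt_id ξ).sub_const a).pow 2).const_mul (f₂ a / 2))).sub
        ((((hasDerivAt_id ξ).sub_const a).pow 3).const_mul (f₃ a / 6))
      convert! h using 1; simp; ring) b₁ w Set.right_mem_uIcc
  have e : M * (w - a) ^ 4 = M * |w - a| * |w - a| * |w - a| * |w - a| := by
    have : (w - a) ^ 4 = |w - a| ^ 4 := by rw [pow_abs, abs_of_nonneg (by positivity)]
    rw [this]; ring
  rw [e]
  convert! b₀ using 2
  ring

lemma hasDerivAt_powExpKernel (j q : ℝ) {w : ℝ} (hw : 0 < w) :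
    HasDerivAt (powExpKernel j q)
      (-(j + 1 / 2) * powExpKernel (j + 1) q w + q * powExpKernel (j + 2) q w) w := by
  have h1 : powExpKernel (j + 1) q w = powExpKernel j q w * w⁻¹ := by
    have : w⁻¹ = Real.exp (-Real.log w) := by rw [Real.exp_neg, Real.exp_log hw]
    rw [powExpKernel, powExpKernel, this, ← Real.exp_add, ← this]
    congr 1; ring
  have h2 : powExpKernel (j + 2) q w = powExpKernel j q w * (w ^ 2)⁻¹ := by
    have : (w ^ 2)⁻¹ = Real.exp (-(2 * Real.log w)) := by
      rw [Real.exp_neg, two_mul, Real.exp_add, Real.exp_log hw, sq]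
    rw [powExpKernel, powExpKernel, this, ← Real.exp_add]
    congr 1; ring
  have h := (((Real.hasDerivAt_log hw.ne').const_mul (-(j + 1 / 2))).add
    (((hasDerivAt_inv hw.ne').const_sub 1).const_mul q)).exp
  convert! h using 1
  rw [h1, h2, powExpKernel]
  simp only [Pi.add_apply]
  ring

lemma powExpKernel_one (j q : ℝ) : powExpKernel j q 1 = 1 := by simp [powExpKernel]

/-- Left of `1` the exponential factor is at most `1` and the power is at most `w⁻¹ ^ 9`, as `j +
1/2 ≤ 9`. Right of `1` the power is at most `1` and `1 - ξ⁻¹ ≤ w - 1`. The sum covers both cases. -/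
lemma powExpKernel_le {j q w ξ : ℝ} (hj : 0 ≤ j) (hj' : j ≤ 8) (hq : 0 ≤ q) (hw : 0 < w)
    (hξ : ξ ∈ Set.uIcc 1 w) :
    powExpKernel j q ξ ≤ w⁻¹ ^ 9 + Real.exp (q * (w - 1)) := by
  rcases le_total w 1 with h | h
  · rw [Set.uIcc_of_ge h] at hξ
    have hξ0 : 0 < ξ := hw.trans_le hξ.1
    have h1 : powExpKernel j q ξ ≤ w⁻¹ ^ 9 := by
      have e : w⁻¹ ^ 9 = Real.exp (9 * -Real.log w) := by
        rw [← Real.log_inv, mul_comm, Real.exp_mul, Real.exp_log (by positivity)]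
        norm_cast
      rw [e, powExpKernel]
      refine Real.exp_le_exp.mpr ?_
      have a1 : Real.log w ≤ Real.log ξ := Real.log_le_log hw hξ.1
      have a2 : Real.log ξ ≤ 0 := Real.log_nonpos hξ0.le hξ.2
      have a3 : 1 - ξ⁻¹ ≤ 0 := by linarith [(one_le_inv₀ hξ0).mpr hξ.2]
      nlinarith [mul_nonneg hq (neg_nonneg.mpr a3)]
    linarith [Real.exp_pos (q * (w - 1))]
  · rw [Set.uIcc_of_le h] at hξ
    have hξ0 : 0 < ξ := one_pos.trans_le hξ.1
    have h1 : powExpKernel j q ξ ≤ Real.exp (q * (w - 1)) := by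
      refine Real.exp_le_exp.mpr ?_
      have a1 : 0 ≤ Real.log ξ := Real.log_nonneg hξ.1
      have a2 := Real.one_sub_inv_le_log_of_pos hξ0
      have a3 := Real.log_le_sub_one_of_pos hξ0
      have a4 : q * (1 - ξ⁻¹) ≤ q * (w - 1) :=
        mul_le_mul_of_nonneg_left (by linarith [hξ.2]) hq
      nlinarith
    have : 0 < w⁻¹ ^ 9 := by positivity
    linarith

lemma abs_powExpKernel_sub_taylor_le {q w : ℝ} (hq : 0 ≤ q) (hw : 0 < w) :
    |powExpKernel 0 q w - (1 + (q - 1 / 2) * (w - 1) + (q ^ 2 - 3 * q + 3 / 4) / 2 * (w - 1) ^ 2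
      + (q ^ 3 - 15 / 2 * q ^ 2 + 45 / 4 * q - 15 / 8) / 6 * (w - 1) ^ 3)|
      ≤ 53 * (1 + q) ^ 4 * (w⁻¹ ^ 9 + Real.exp (q * (w - 1))) * (w - 1) ^ 4 := by
  have pos : ∀ ξ ∈ Set.uIcc 1 w, 0 < ξ := fun ξ hξ =>
    (lt_min one_pos hw).trans_le hξ.1
  have h := abs_sub_cubic_taylor_le (a := 1) (w := w)
    (M := 53 * (1 + q) ^ 4 * (w⁻¹ ^ 9 + Real.exp (q * (w - 1))))
    (f₀ := powExpKernel 0 q)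
    (f₁ := fun ξ => -(1 / 2) * powExpKernel 1 q ξ + q * powExpKernel 2 q ξ)
    (f₂ := fun ξ => 3 / 4 * powExpKernel 2 q ξ - 3 * q * powExpKernel 3 q ξ
      + q ^ 2 * powExpKernel 4 q ξ)
    (f₃ := fun ξ => -(15 / 8) * powExpKernel 3 q ξ + 45 / 4 * q * powExpKernel 4 q ξ
      - 15 / 2 * q ^ 2 * powExpKernel 5 q ξ + q ^ 3 * powExpKernel 6 q ξ)
    (f₄ := fun ξ => 105 / 16 * powExpKernel 4 q ξ - 105 / 2 * q * powExpKernel 5 q ξ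
      + 105 / 2 * q ^ 2 * powExpKernel 6 q ξ - 14 * q ^ 3 * powExpKernel 7 q ξ
      + q ^ 4 * powExpKernel 8 q ξ)
    (fun ξ hξ => by
      convert! hasDerivAt_powExpKernel 0 q (pos ξ hξ) using 1; norm_num)
    (fun ξ hξ => by
      convert! ((hasDerivAt_powExpKernel 1 q (pos ξ hξ)).const_mul (-(1 / 2))).add
        ((hasDerivAt_powExpKernel 2 q (pos ξ hξ)).const_mul q) using 1
      norm_num; ring)
    (fun ξ hξ => by
      convert! (((hasDerivAt_powExpKernel 2 q (pos ξ hξ)).const_mul (3 / 4)).sub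
        ((hasDerivAt_powExpKernel 3 q (pos ξ hξ)).const_mul (3 * q))).add
        ((hasDerivAt_powExpKernel 4 q (pos ξ hξ)).const_mul (q ^ 2)) using 1
      norm_num; ring)
    (fun ξ hξ => by
      convert! ((((hasDerivAt_powExpKernel 3 q (pos ξ hξ)).const_mul (-(15 / 8))).add
        ((hasDerivAt_powExpKernel 4 q (pos ξ hξ)).const_mul (45 / 4 * q))).sub
        ((hasDerivAt_powExpKernel 5 q (pos ξ hξ)).const_mul (15 / 2 * q ^ 2))).add
        ((hasDerivAt_powExpKernel 6 q (pos ξ hξ)).const_mul (q ^ 3)) using 1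
      norm_num; ring)
    (fun ξ hξ => by
      set S := w⁻¹ ^ 9 + Real.exp (q * (w - 1))
      have b : ∀ j : ℝ, 0 ≤ j → j ≤ 8 → powExpKernel j q ξ ≤ S := fun j hj hj' =>
        powExpKernel_le hj hj' hq hw hξ
      have e4 := b 4 (by norm_num) (by norm_num)
      have e5 := mul_le_mul_of_nonneg_left (b 5 (by norm_num) (by norm_num)) hq
      have e6 := mul_le_mul_of_nonneg_left (b 6 (by norm_num) (by norm_num)) (pow_nonneg hq 2)
      have e7 := mul_le_mul_of_nonneg_left (b 7 (by norm_num) (by norm_num)) (pow_nonneg hq 3)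
      have e8 := mul_le_mul_of_nonneg_left (b 8 (by norm_num) (by norm_num)) (pow_nonneg hq 4)
      have p4 := powExpKernel_pos 4 q ξ
      have p5 := mul_nonneg hq (powExpKernel_pos 5 q ξ).le
      have p6 := mul_nonneg (pow_nonneg hq 2) (powExpKernel_pos 6 q ξ).le
      have p7 := mul_nonneg (pow_nonneg hq 3) (powExpKernel_pos 7 q ξ).le
      have p8 := mul_nonneg (pow_nonneg hq 4) (powExpKernel_pos 8 q ξ).le
      -- The number `53` exceeds the largest coefficient `105 / 2` of `f₄`, so the bound holds
      -- monomial by monomial in `q`.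
      have e : 53 * (1 + q) ^ 4 * S = 53 * S + 212 * (q * S) + 318 * (q ^ 2 * S)
        + 212 * (q ^ 3 * S) + 53 * (q ^ 4 * S) := by ring
      rw [e, abs_le]
      constructor <;> nlinarith)
  simp only [powExpKernel_one, mul_one] at h
  convert! h using 3
  ring

/-! ### Gaussian moments and the fourth Hermite polynomial. -/

lemma integrable_pow_gaussianReal (n : ℕ) :
    Integrable (fun x : ℝ => x ^ n) (gaussianReal 0 1) :=
  integrable_pow_of_integrable_exp_mul one_ne_zero (integrable_exp_mul_gaussianReal 1)
    (integrable_exp_mul_gaussianReal (-1)) n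

/-- Differentiating `M₁(t) = t M₀(t)` repeatedly, where `Mₙ(t) = E[Xⁿ exp(tX)]`, gives `Mₙ₊₂(t) = t
Mₙ₊₁(t) + (n + 1) Mₙ(t)`; then `t = 0`. -/
lemma integral_pow_add_two_gaussianReal (n : ℕ) :
    ∫ x, x ^ (n + 2) ∂gaussianReal 0 1 = (n + 1) * ∫ x, x ^ n ∂gaussianReal 0 1 := by
  let M : ℕ → ℝ → ℝ := fun n t => ∫ x, x ^ n * Real.exp (t * x) ∂gaussianReal 0 1
  have hM : ∀ n t, HasDerivAt (M n) (M (n + 1) t) t := fun n t =>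
    hasDerivAt_integral_pow_mul_exp_real (X := fun x : ℝ => x)
      (by rw [integrableExpSet_fun_id_gaussianReal]; simp) n
  have h0 : M 0 = fun t => Real.exp (t ^ 2 / 2) := by
    have h := mgf_fun_id_gaussianReal (μ := 0) (v := 1)
    simp only [NNReal.coe_one, zero_mul, zero_add, one_mul] at h
    rw [← h]
    ext t
    simp [mgf, M]
  have h1 : ∀ t, M 1 t = t * M 0 t := by
    intro t
    refine (hM 0 t).unique ?_
    rw [h0]
    have h := (((hasDerivAt_id t).pow 2).div_const 2).exp
    convert! h using 1
    simp only [id]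
    norm_num
    ring
  have hrec : ∀ n t, M (n + 2) t = t * M (n + 1) t + (n + 1) * M n t := by
    intro n
    induction n with
    | zero =>
      intro t
      refine (hM 1 t).unique ?_
      have e : M 1 = fun t => t * M 0 t := funext h1
      rw [e]
      convert! (hasDerivAt_id t).mul (hM 0 t) using 1
      simp only [id, h1, zero_add, Nat.cast_zero]
      ring
    | succ n ih =>
      intro t
      refine (hM (n + 2) t).unique ?_
      have e : M (n + 2) = fun t => t * M (n + 1) t + (n + 1) * M n t := funext ih
      conv in M (n + 2) => rw [e]
      convert! ((hasDerivAt_id t).mul (hM (n + 1) t)).add ((hM n t).const_mul ((n : ℝ) + 1)) using 1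
      simp only [id]
      push_cast
      ring
  simpa [M] using hrec n 0

lemma integral_sq_gaussianReal : ∫ x, x ^ 2 ∂gaussianReal 0 1 = 1 := by
  simpa using integral_pow_add_two_gaussianReal 0

lemma integral_pow_four_gaussianReal : ∫ x, x ^ 4 ∂gaussianReal 0 1 = 3 := by
  rw [integral_pow_add_two_gaussianReal 2, integral_sq_gaussianReal]; norm_num

lemma integral_pow_six_gaussianReal : ∫ x, x ^ 6 ∂gaussianReal 0 1 = 15 := by
  rw [integral_pow_add_two_gaussianReal 4, integral_pow_four_gaussianReal]; norm_num

lemma integral_pow_eight_gaussianReal : ∫ x, x ^ 8 ∂gaussianReal 0 1 = 105 := by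
  rw [integral_pow_add_two_gaussianReal 6, integral_pow_six_gaussianReal]; norm_num

lemma integral_pow_ten_gaussianReal : ∫ x, x ^ 10 ∂gaussianReal 0 1 = 945 := by
  rw [integral_pow_add_two_gaussianReal 8, integral_pow_eight_gaussianReal]; norm_num

lemma integral_pow_twelve_gaussianReal : ∫ x, x ^ 12 ∂gaussianReal 0 1 = 10395 := by
  rw [integral_pow_add_two_gaussianReal 10, integral_pow_ten_gaussianReal]; norm_num

/-- The fourth probabilists' Hermite polynomial. -/
noncomputable def hermiteFour (x : ℝ) : ℝ := x ^ 4 - 6 * x ^ 2 + 3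

lemma integral_hermiteFour : ∫ x, hermiteFour x ∂gaussianReal 0 1 = 0 := by
  have i := integrable_pow_gaussianReal
  unfold hermiteFour
  rw [integral_add ((i 4).sub' ((i 2).const_mul 6)) (integrable_const 3),
    integral_sub (i 4) ((i 2).const_mul 6), integral_const_mul, integral_pow_four_gaussianReal,
    integral_sq_gaussianReal]
  simp; norm_num

lemma integral_hermiteFour_sq : ∫ x, hermiteFour x ^ 2 ∂gaussianReal 0 1 = 24 := by
  have i := integrable_pow_gaussianReal
  have e : ∀ x, hermiteFour x ^ 2 = x ^ 8 - 12 * x ^ 6 + 42 * x ^ 4 - 36 * x ^ 2 + 9 := by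
    intro x; unfold hermiteFour; ring
  simp_rw [e]
  rw [integral_add ((((i 8).sub' ((i 6).const_mul 12)).fun_add ((i 4).const_mul 42)).sub'
      ((i 2).const_mul 36)) (integrable_const 9),
    integral_sub (((i 8).sub' ((i 6).const_mul 12)).fun_add ((i 4).const_mul 42)) ((i 2).const_mul 36),
    integral_add ((i 8).sub' ((i 6).const_mul 12)) ((i 4).const_mul 42),
    integral_sub (i 8) ((i 6).const_mul 12)]
  simp only [integral_const_mul, integral_pow_four_gaussianReal,
    integral_sq_gaussianReal, integral_pow_six_gaussianReal, integral_pow_eight_gaussianReal]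
  simp; norm_num

lemma integral_hermiteFour_cube : ∫ x, hermiteFour x ^ 3 ∂gaussianReal 0 1 = 1728 := by
  have i := integrable_pow_gaussianReal
  have e : ∀ x, hermiteFour x ^ 3 = x ^ 12 - 18 * x ^ 10 + 117 * x ^ 8 - 324 * x ^ 6
      + 351 * x ^ 4 - 162 * x ^ 2 + 27 := by
    intro x; unfold hermiteFour; ring
  simp_rw [e]
  have i1 := (i 12).sub' ((i 10).const_mul 18)
  have i2 := i1.fun_add ((i 8).const_mul 117)
  have i3 := i2.sub' ((i 6).const_mul 324)
  have i4 := i3.fun_add ((i 4).const_mul 351)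
  have i5 := i4.sub' ((i 2).const_mul 162)
  rw [integral_add i5 (integrable_const 27), integral_sub i4 ((i 2).const_mul 162),
    integral_add i3 ((i 4).const_mul 351), integral_sub i2 ((i 6).const_mul 324),
    integral_add i1 ((i 8).const_mul 117), integral_sub (i 12) ((i 10).const_mul 18)]
  simp only [integral_const_mul, integral_pow_four_gaussianReal,
    integral_sq_gaussianReal, integral_pow_six_gaussianReal, integral_pow_eight_gaussianReal,
    integral_pow_ten_gaussianReal, integral_pow_twelve_gaussianReal]
  simp; norm_num

/-! ### Mixing laws concentrated at `1`. -/

lemma powExpKernel_zero_le {q w : ℝ} (hq : 0 ≤ q) (hw : 0 < w) :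
    powExpKernel 0 q w ≤ Real.exp q * (1 + w⁻¹ ^ 18) := by
  have h1 : powExpKernel 0 q w ≤ Real.exp q * Real.exp (-(1 / 2) * Real.log w) := by
    rw [powExpKernel, ← Real.exp_add]
    refine Real.exp_le_exp.mpr ?_
    have : 0 ≤ q * w⁻¹ := by positivity
    linarith
  refine h1.trans (mul_le_mul_of_nonneg_left ?_ (Real.exp_pos q).le)
  have e : w⁻¹ ^ 18 = Real.exp (18 * -Real.log w) := by
    rw [← Real.log_inv, mul_comm, Real.exp_mul, Real.exp_log (by positivity)]
    norm_cast
  rw [e]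
  rcases le_total 0 (Real.log w) with hl | hl
  · have : Real.exp (-(1 / 2) * Real.log w) ≤ 1 := Real.exp_le_one_iff.mpr (by linarith)
    linarith [Real.exp_pos (18 * -Real.log w)]
  · have : Real.exp (-(1 / 2) * Real.log w) ≤ Real.exp (18 * -Real.log w) :=
      Real.exp_le_exp.mpr (by linarith)
    linarith

/-- A probability measure on `(0, ∞)` with mean `1` and variance `ε` whose tails on the scale
`√ε`, third moment and eighteenth inverse moment are controlled by `C`. -/
structure IsConcentratedAtOne (ε C : ℝ) (μ : Measure ℝ) : Prop where
  pos : ∀ᵐ w ∂μ, 0 < w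
  mean : ∫ w, (w - 1) ∂μ = 0
  variance : ∫ w, (w - 1) ^ 2 ∂μ = ε
  third : |∫ w, (w - 1) ^ 3 ∂μ| ≤ C * ε ^ 2
  exp_int : ∀ s : ℝ, ε * s ^ 2 ≤ 1 → Integrable (fun w => Real.exp (s * (w - 1))) μ
  exp_le : ∀ s : ℝ, ε * s ^ 2 ≤ 1 → ∫ w, Real.exp (s * (w - 1)) ∂μ ≤ C
  inv_int : Integrable (fun w : ℝ => w⁻¹ ^ 18) μ
  inv_le : ∫ w, w⁻¹ ^ 18 ∂μ ≤ C

namespace IsConcentratedAtOne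

variable {ε C : ℝ} {μ : Measure ℝ}

lemma integrable_pow (h : IsConcentratedAtOne ε C μ) (hε1 : ε ≤ 1) (n : ℕ) :
    Integrable (fun w : ℝ => (w - 1) ^ n) μ :=
  integrable_pow_of_integrable_exp_mul (X := fun w : ℝ => w - 1) one_ne_zero
    (h.exp_int 1 (by linarith)) (h.exp_int (-1) (by linarith)) n

/-- The exponential moments at `s = ±1 / √ε` control the fluctuations on the scale `√ε`. From `y⁸ /
8! ≤ exp |y|` with `y = s (w - 1)` comes the constant `80640 = 2 * 8!`. -/
lemma integral_pow_eight_le (h : IsConcentratedAtOne ε C μ) (hε : 0 < ε) (hε1 : ε ≤ 1) :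
    ∫ w, (w - 1) ^ 8 ∂μ ≤ 80640 * C * ε ^ 4 := by
  set s := (√ε)⁻¹ with hs
  have hs2 : ε * s ^ 2 ≤ 1 := by
    rw [hs, inv_pow, Real.sq_sqrt hε.le, mul_inv_cancel₀ hε.ne']
  have hs2' : ε * (-s) ^ 2 ≤ 1 := by rwa [neg_sq]
  have hs8 : s ^ 8 = (ε ^ 4)⁻¹ := by
    have : √ε ^ 8 = ε ^ 4 := by
      rw [show √ε ^ 8 = (√ε ^ 2) ^ 4 by ring, Real.sq_sqrt hε.le]
    rw [hs, inv_pow, this]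
  have hb : ∀ w : ℝ, (w - 1) ^ 8 ≤
      40320 * ε ^ 4 * (Real.exp (s * (w - 1)) + Real.exp (-s * (w - 1))) := by
    intro w
    have h1 := Real.pow_div_factorial_le_exp _ (abs_nonneg (s * (w - 1))) 8
    have h2 : |s * (w - 1)| ^ 8 = (ε ^ 4)⁻¹ * (w - 1) ^ 8 := by
      rw [← hs8, ← mul_pow, pow_abs, abs_of_nonneg (by positivity)]
    have h3 : Real.exp |s * (w - 1)| ≤
        Real.exp (s * (w - 1)) + Real.exp (-s * (w - 1)) := by
      rw [neg_mul]
      rcases abs_choice (s * (w - 1)) with e | e <;> rw [e] <;>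
        linarith [Real.exp_pos (s * (w - 1)), Real.exp_pos (-(s * (w - 1)))]
    rw [h2] at h1
    have h4 := h1.trans h3
    have h5 : ((8 : ℕ).factorial : ℝ) = 40320 := by norm_num [Nat.factorial]
    rw [h5, div_le_iff₀ (by norm_num), inv_mul_le_iff₀ (by positivity)] at h4
    linarith
  have hi := (h.exp_int s hs2).add (h.exp_int (-s) hs2')
  calc ∫ w, (w - 1) ^ 8 ∂μ
      ≤ ∫ w, 40320 * ε ^ 4 * (Real.exp (s * (w - 1)) + Real.exp (-s * (w - 1))) ∂μ :=
        integral_mono (h.integrable_pow hε1 8) (hi.const_mul _) hb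
    _ = 40320 * ε ^ 4 * (∫ w, Real.exp (s * (w - 1)) ∂μ + ∫ w, Real.exp (-s * (w - 1)) ∂μ) := by
        rw [integral_const_mul, integral_add (h.exp_int s hs2) (h.exp_int (-s) hs2')]
    _ ≤ 40320 * ε ^ 4 * (C + C) := by
        have := h.exp_le s hs2
        have := h.exp_le (-s) hs2'
        gcongr
    _ = _ := by ring

lemma integral_id_eq [IsProbabilityMeasure μ] (h : IsConcentratedAtOne ε C μ) (hε1 : ε ≤ 1) :
    Integrable (fun w : ℝ => w) μ ∧ ∫ w, w ∂μ = 1 := by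
  have i1 : Integrable (fun w : ℝ => w - 1) μ := by simpa using h.integrable_pow hε1 1
  have e : (fun w : ℝ => w) = fun w => (w - 1) + 1 := by ext; ring
  rw [e]
  refine ⟨i1.add (integrable_const 1), ?_⟩
  rw [integral_add i1 (integrable_const 1), h.mean]
  simp

lemma integral_sq_eq [IsProbabilityMeasure μ] (h : IsConcentratedAtOne ε C μ) (hε1 : ε ≤ 1) :
    Integrable (fun w : ℝ => w ^ 2) μ ∧ ∫ w, w ^ 2 ∂μ = 1 + ε := by
  have i1 : Integrable (fun w : ℝ => w - 1) μ := by simpa using h.integrable_pow hε1 1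
  have i2 := h.integrable_pow hε1 2
  have e : (fun w : ℝ => w ^ 2) = fun w => (w - 1) ^ 2 + 2 * (w - 1) + 1 := by ext; ring
  rw [e]
  refine ⟨(i2.fun_add (i1.const_mul 2)).add (integrable_const 1), ?_⟩
  rw [integral_add (i2.fun_add (i1.const_mul 2)) (integrable_const 1),
    integral_add i2 (i1.const_mul 2), integral_const_mul, h.mean, h.variance]
  simp; ring

lemma integrable_one_add_pow (h : IsConcentratedAtOne ε C μ) (hε1 : ε ≤ 1) (n : ℕ) :
    Integrable (fun w : ℝ => (1 + w) ^ n) μ ∧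
      ∫ w, (1 + w) ^ n ∂μ ≤ n.factorial * Real.exp 2 * C := by
  have hb : ∀ᵐ w ∂μ, (1 + w) ^ n ≤ n.factorial * Real.exp 2 * Real.exp (1 * (w - 1)) := by
    filter_upwards [h.pos] with w hw
    have h1 := Real.pow_div_factorial_le_exp _ (by linarith : 0 ≤ 1 + w) n
    rw [div_le_iff₀ (by positivity)] at h1
    have h2 : Real.exp (1 + w) = Real.exp 2 * Real.exp (1 * (w - 1)) := by
      rw [← Real.exp_add]; congr 1; ring
    rw [h2] at h1
    linarith
  have hi := (h.exp_int 1 (by linarith)).const_mul (n.factorial * Real.exp 2)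
  have i : Integrable (fun w : ℝ => (1 + w) ^ n) μ := by
    refine hi.mono' (by fun_prop) ?_
    filter_upwards [hb, h.pos] with w hw hw0
    rwa [Real.norm_of_nonneg (by positivity)]
  refine ⟨i, (integral_mono_ae i hi hb).trans ?_⟩
  rw [integral_const_mul]
  exact mul_le_mul_of_nonneg_left (h.exp_le 1 (by linarith)) (by positivity)

lemma integrable_powExpKernel [IsProbabilityMeasure μ] (h : IsConcentratedAtOne ε C μ) {q : ℝ}
    (hq : 0 ≤ q) : Integrable (powExpKernel 0 q) μ := by
  refine (((integrable_const 1).add h.inv_int).const_mul (Real.exp q)).mono'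
    (measurable_powExpKernel_right 0 q).aestronglyMeasurable ?_
  filter_upwards [h.pos] with w hw
  rw [Real.norm_of_nonneg (powExpKernel_pos _ _ _).le]
  exact powExpKernel_zero_le hq hw

/-- Gives `log r` at most quadratic growth in `x`, which is what the region of large `x` requires.
-/
lemma mixtureDensity_le [IsProbabilityMeasure μ] (h : IsConcentratedAtOne ε C μ) (x : ℝ) :
    mixtureDensity μ x ≤ Real.exp (x ^ 2 / 2) * (1 + C) := by
  have hq : 0 ≤ x ^ 2 / 2 := by positivity
  have hi := ((integrable_const (1 : ℝ)).add h.inv_int).const_mul (Real.exp (x ^ 2 / 2))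
  have h1 : mixtureDensity μ x ≤ ∫ w, Real.exp (x ^ 2 / 2) * (1 + w⁻¹ ^ 18) ∂μ := by
    refine integral_mono_ae (h.integrable_powExpKernel hq) hi ?_
    filter_upwards [h.pos] with w hw using powExpKernel_zero_le hq hw
  refine h1.trans ?_
  rw [integral_const_mul, integral_add (integrable_const 1) h.inv_int]
  have := h.inv_le
  simp only [integral_const, probReal_univ, smul_eq_mul, mul_one]
  gcongr

end IsConcentratedAtOne

/-! ### Second-order expansion of the mixture density. -/

lemma mixtureDensity_nonneg (μ : Measure ℝ) (x : ℝ) : 0 ≤ mixtureDensity μ x :=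
  integral_nonneg fun _ => (powExpKernel_pos _ _ _).le

lemma measurable_mixtureDensity (μ : Measure ℝ) [IsProbabilityMeasure μ] :
    Measurable (mixtureDensity μ) := by
  have h : StronglyMeasurable fun p : ℝ × ℝ => powExpKernel 0 (p.1 ^ 2 / 2) p.2 :=
    (measurable_powExpKernel.comp measurable_swap).stronglyMeasurable
  exact h.integral_prod_right.measurable

lemma integrable_one_add_sq_pow_gaussianReal (m : ℕ) :
    Integrable (fun y : ℝ => (1 + y ^ 2) ^ m) (gaussianReal 0 1) := by
  have e : (fun y : ℝ => (1 + y ^ 2) ^ m) =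
      fun y => ∑ i ∈ Finset.range (m + 1), (m.choose i : ℝ) * y ^ (2 * i) := by
    ext y
    rw [add_comm, add_pow]
    exact Finset.sum_congr rfl fun i _ => by rw [← pow_mul, one_pow]; ring
  rw [e]
  exact integrable_finsetSum _ fun i _ => (integrable_pow_gaussianReal (2 * i)).const_mul _

/-- The second order part of the expansion of a variance mixture density around `1`. -/
noncomputable def mixtureRemainder (μ : Measure ℝ) (ε x : ℝ) : ℝ :=
  mixtureDensity μ x - 1 - ε / 8 * hermiteFour x

namespace IsConcentratedAtOne

variable {ε C : ℝ} {μ : Measure ℝ}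

lemma one_le [IsProbabilityMeasure μ] (h : IsConcentratedAtOne ε C μ) : 1 ≤ C := by
  simpa using h.exp_le 0 (by simp)

lemma integrable_varianceMixture [IsProbabilityMeasure μ] (h : IsConcentratedAtOne ε C μ)
    (hε1 : ε ≤ 1) (m : ℕ) :
    Integrable (fun x : ℝ => (1 + x ^ 2) ^ m) (varianceMixture μ) ∧
      ∫ x, (1 + x ^ 2) ^ m ∂varianceMixture μ ≤
        m.factorial * Real.exp 2 * C * ∫ y, (1 + y ^ 2) ^ m ∂gaussianReal 0 1 := by
  have hm : Measurable fun p : ℝ × ℝ => √p.1 * p.2 := by fun_prop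
  have hw := h.integrable_one_add_pow hε1 m
  have hy := integrable_one_add_sq_pow_gaussianReal m
  have hprod := hw.1.mul_prod hy
  have hpos : ∀ᵐ p ∂(μ.prod (gaussianReal 0 1)), 0 < p.1 :=
    Measure.quasiMeasurePreserving_fst.ae h.pos
  have hb : ∀ᵐ p ∂(μ.prod (gaussianReal 0 1)),
      (1 + (√p.1 * p.2) ^ 2) ^ m ≤ (1 + p.1) ^ m * (1 + p.2 ^ 2) ^ m := by
    filter_upwards [hpos] with p hp
    rw [← mul_pow, mul_pow (√p.1), Real.sq_sqrt hp.le]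
    refine pow_le_pow_left₀ (by positivity) ?_ m
    nlinarith [sq_nonneg p.2]
  have hi : Integrable (fun p : ℝ × ℝ => (1 + (√p.1 * p.2) ^ 2) ^ m)
      (μ.prod (gaussianReal 0 1)) := by
    refine hprod.mono' (by fun_prop) ?_
    filter_upwards [hb] with p hp
    rwa [Real.norm_of_nonneg (by positivity)]
  rw [varianceMixture_eq_map μ h.pos]
  refine ⟨(integrable_map_measure (by fun_prop) hm.aemeasurable).mpr hi, ?_⟩
  rw [integral_map hm.aemeasurable (by fun_prop)]
  refine (integral_mono_ae hi hprod hb).trans ?_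
  rw [integral_prod_mul (fun w : ℝ => (1 + w) ^ m) (fun y : ℝ => (1 + y ^ 2) ^ m)]
  exact mul_le_mul_of_nonneg_right hw.2 (integral_nonneg fun y => by positivity)

/-- The value is `3 E W² - 6 E W + 3`. It is this exact identity that makes the cross term in the
expansion vanish. -/
lemma integral_hermiteFour_varianceMixture [IsProbabilityMeasure μ]
    (h : IsConcentratedAtOne ε C μ) (hε1 : ε ≤ 1) :
    ∫ x, hermiteFour x ∂varianceMixture μ = 3 * ε := by
  have hm : Measurable fun p : ℝ × ℝ => √p.1 * p.2 := by fun_prop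
  have hpos : ∀ᵐ p ∂(μ.prod (gaussianReal 0 1)), 0 < p.1 :=
    Measure.quasiMeasurePreserving_fst.ae h.pos
  rw [varianceMixture_eq_map μ h.pos,
    integral_map hm.aemeasurable (by unfold hermiteFour; fun_prop)]
  have e : (fun p : ℝ × ℝ => hermiteFour (√p.1 * p.2)) =ᵐ[μ.prod (gaussianReal 0 1)]
      fun p => p.1 ^ 2 * p.2 ^ 4 - 6 * (p.1 * p.2 ^ 2) + 3 := by
    filter_upwards [hpos] with p hp
    have h2 := Real.sq_sqrt hp.le
    have h4 : √p.1 ^ 4 = p.1 ^ 2 := by rw [show √p.1 ^ 4 = (√p.1 ^ 2) ^ 2 by ring, h2]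
    rw [hermiteFour, mul_pow, mul_pow, h2, h4]
  have i4 := (h.integral_sq_eq hε1).1.mul_prod (integrable_pow_gaussianReal 4)
  have i2 := (h.integral_id_eq hε1).1.mul_prod (integrable_pow_gaussianReal 2)
  rw [integral_congr_ae e, integral_add (i4.sub' (i2.const_mul 6)) (integrable_const 3),
    integral_sub i4 (i2.const_mul 6), integral_const_mul,
    integral_prod_mul (fun w : ℝ => w ^ 2) (fun y : ℝ => y ^ 4),
    integral_prod_mul (fun w : ℝ => w) (fun y : ℝ => y ^ 2), (h.integral_sq_eq hε1).2,
    (h.integral_id_eq hε1).2, integral_pow_four_gaussianReal, integral_sq_gaussianReal]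
  simp; ring

lemma varianceMixture_eq [IsProbabilityMeasure μ] (h : IsConcentratedAtOne ε C μ) :
    varianceMixture μ =
      (gaussianReal 0 1).withDensity fun x => ENNReal.ofReal (mixtureDensity μ x) :=
  varianceMixture_eq_withDensity μ h.pos fun _ => h.integrable_powExpKernel (by positivity)

lemma integrable_mixtureDensity_mul [IsProbabilityMeasure μ] (h : IsConcentratedAtOne ε C μ)
    {F : ℝ → ℝ} (hF : Integrable F (varianceMixture μ)) :
    Integrable (fun x => mixtureDensity μ x * F x) (gaussianReal 0 1) := by
  rw [h.varianceMixture_eq, integrable_withDensity_iff_integrable_smul'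
    (measurable_mixtureDensity μ).ennreal_ofReal (ae_of_all _ fun _ => ENNReal.ofReal_lt_top)] at hF
  simpa only [ENNReal.toReal_ofReal (mixtureDensity_nonneg μ _), smul_eq_mul] using hF

lemma integral_mixtureDensity_mul [IsProbabilityMeasure μ] (h : IsConcentratedAtOne ε C μ)
    (F : ℝ → ℝ) :
    ∫ x, mixtureDensity μ x * F x ∂gaussianReal 0 1 = ∫ x, F x ∂varianceMixture μ := by
  rw [h.varianceMixture_eq, integral_withDensity_eq_integral_toReal_smul
    (measurable_mixtureDensity μ).ennreal_ofReal (ae_of_all _ fun _ => ENNReal.ofReal_lt_top)]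
  simp only [ENNReal.toReal_ofReal (mixtureDensity_nonneg μ _), smul_eq_mul]

/-- In the Taylor expansion under `μ` the linear term has mean zero and the quadratic one is exactly
`ε / 8 * hermiteFour x`. The cubic term is `O(ε²)` by the third-moment bound. In the remainder the
exponential moment is needed at `s = 2q = x²`, and it is available exactly because `ε x⁴ ≤ 1`. -/
lemma abs_mixtureRemainder_le [IsProbabilityMeasure μ] (h : IsConcentratedAtOne ε C μ)
    (hε : 0 < ε) (hε1 : ε ≤ 1) {x : ℝ} (hx : ε * x ^ 4 ≤ 1) :
    |mixtureRemainder μ ε x| ≤ 3000000 * C * ε ^ 2 * (1 + x ^ 2) ^ 4 := by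
  set q := x ^ 2 / 2 with hq
  have hq0 : 0 ≤ q := by positivity
  have hC := h.one_le
  set c₃ := (q ^ 3 - 15 / 2 * q ^ 2 + 45 / 4 * q - 15 / 8) / 6 with hc₃
  set a₂ := (q ^ 2 - 3 * q + 3 / 4) / 2 with ha₂
  have i1 : Integrable (fun w : ℝ => w - 1) μ := by simpa using h.integrable_pow hε1 1
  have i2 := h.integrable_pow hε1 2
  have i3 := h.integrable_pow hε1 3
  have i8 := h.integrable_pow hε1 8
  have iK := h.integrable_powExpKernel hq0
  have hs : ε * (2 * q) ^ 2 ≤ 1 := by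
    rw [hq]; calc ε * (2 * (x ^ 2 / 2)) ^ 2 = ε * x ^ 4 := by ring
      _ ≤ 1 := hx
  have ie := h.exp_int (2 * q) hs
  have ip := (((integrable_const (1 : ℝ)).fun_add (i1.const_mul (q - 1 / 2))).fun_add
    (i2.const_mul a₂)).fun_add (i3.const_mul c₃)
  have hpoly : ∫ w, (1 + (q - 1 / 2) * (w - 1) + a₂ * (w - 1) ^ 2 + c₃ * (w - 1) ^ 3) ∂μ =
      1 + a₂ * ε + c₃ * ∫ w, (w - 1) ^ 3 ∂μ := by
    rw [integral_add (((integrable_const (1 : ℝ)).fun_add (i1.const_mul (q - 1 / 2))).fun_add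
      (i2.const_mul a₂)) (i3.const_mul c₃),
      integral_add ((integrable_const (1 : ℝ)).fun_add (i1.const_mul (q - 1 / 2)))
      (i2.const_mul a₂), integral_add (integrable_const (1 : ℝ)) (i1.const_mul (q - 1 / 2)),
      integral_const_mul, integral_const_mul, integral_const_mul, h.mean, h.variance]
    simp
  have hsplit : mixtureRemainder μ ε x = c₃ * ∫ w, (w - 1) ^ 3 ∂μ +
      ∫ w, (powExpKernel 0 q w
        - (1 + (q - 1 / 2) * (w - 1) + a₂ * (w - 1) ^ 2 + c₃ * (w - 1) ^ 3)) ∂μ := by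
    rw [integral_sub iK ip, hpoly, mixtureRemainder, mixtureDensity, hermiteFour, ha₂, hq]
    ring
  have hbound : ∀ᵐ w ∂μ, ‖powExpKernel 0 q w
      - (1 + (q - 1 / 2) * (w - 1) + a₂ * (w - 1) ^ 2 + c₃ * (w - 1) ^ 3)‖ ≤
      53 * (1 + q) ^ 4 * ((ε ^ 2)⁻¹ / 2 * (w - 1) ^ 8
        + ε ^ 2 * (w⁻¹ ^ 18 + Real.exp (2 * q * (w - 1)))) := by
    filter_upwards [h.pos] with w hw
    have hT := abs_powExpKernel_sub_taylor_le hq0 hw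
    rw [Real.norm_eq_abs]
    refine hT.trans ?_
    rw [mul_assoc (53 * (1 + q) ^ 4)]
    refine mul_le_mul_of_nonneg_left ?_ (by positivity)
    set A := w⁻¹ ^ 9
    set B := Real.exp (q * (w - 1))
    have hA : w⁻¹ ^ 18 = A ^ 2 := by rw [← pow_mul]
    have hB : Real.exp (2 * q * (w - 1)) = B ^ 2 := by
      rw [← Real.exp_nat_mul]; congr 1; push_cast; ring
    have hD : (w - 1) ^ 8 = ((w - 1) ^ 4) ^ 2 := by ring
    rw [hA, hB, hD]
    set t := (w - 1) ^ 4
    have e1 : (ε ^ 2)⁻¹ / 2 * t ^ 2 + ε ^ 2 * (A ^ 2 + B ^ 2) - (A + B) * t =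
        (t / ε - ε * (A + B)) ^ 2 / 2 + ε ^ 2 * (A - B) ^ 2 / 2 := by
      field_simp
      ring
    have e2 : 0 ≤ (t / ε - ε * (A + B)) ^ 2 / 2 + ε ^ 2 * (A - B) ^ 2 / 2 := by positivity
    linarith
  have ib := ((i8.const_mul ((ε ^ 2)⁻¹ / 2)).fun_add
    ((h.inv_int.fun_add ie).const_mul (ε ^ 2))).const_mul (53 * (1 + q) ^ 4)
  have hint := norm_integral_le_of_norm_le ib hbound
  rw [integral_const_mul, integral_add (i8.const_mul ((ε ^ 2)⁻¹ / 2))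
    ((h.inv_int.fun_add ie).const_mul (ε ^ 2)), integral_const_mul, integral_const_mul,
    integral_add h.inv_int ie, Real.norm_eq_abs] at hint
  have h8 : (ε ^ 2)⁻¹ / 2 * ∫ w, (w - 1) ^ 8 ∂μ ≤ 40320 * C * ε ^ 2 := by
    calc (ε ^ 2)⁻¹ / 2 * ∫ w, (w - 1) ^ 8 ∂μ
        ≤ (ε ^ 2)⁻¹ / 2 * (80640 * C * ε ^ 4) :=
          mul_le_mul_of_nonneg_left (h.integral_pow_eight_le hε hε1) (by positivity)
      _ = 40320 * C * ε ^ 2 := by field_simp; norm_num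
  have h9 : ε ^ 2 * (∫ w, w⁻¹ ^ 18 ∂μ + ∫ w, Real.exp (2 * q * (w - 1)) ∂μ) ≤ ε ^ 2 * (C + C) :=
    mul_le_mul_of_nonneg_left (add_le_add h.inv_le (h.exp_le _ hs)) (by positivity)
  have hint' : |∫ w, (powExpKernel 0 q w
      - (1 + (q - 1 / 2) * (w - 1) + a₂ * (w - 1) ^ 2 + c₃ * (w - 1) ^ 3)) ∂μ| ≤
      53 * (1 + q) ^ 4 * (40322 * C * ε ^ 2) := by
    refine hint.trans (mul_le_mul_of_nonneg_left ?_ (by positivity))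
    linarith
  have hc : |c₃| ≤ 2 * (1 + q) ^ 4 := by
    have := pow_nonneg hq0 2
    have := pow_nonneg hq0 3
    have := pow_nonneg hq0 4
    rw [hc₃, abs_le]
    constructor <;> nlinarith
  have h3 : |c₃ * ∫ w, (w - 1) ^ 3 ∂μ| ≤ 2 * (1 + q) ^ 4 * (C * ε ^ 2) := by
    rw [abs_mul]
    exact mul_le_mul hc h.third (abs_nonneg _) (by positivity)
  have hqx : (1 + q) ^ 4 ≤ (1 + x ^ 2) ^ 4 :=
    pow_le_pow_left₀ (by positivity) (by rw [hq]; linarith [sq_nonneg x]) 4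
  rw [hsplit]
  refine (abs_add_le _ _).trans ?_
  have hCe : 0 ≤ C * ε ^ 2 := by positivity
  have hp : (1 + q) ^ 4 * (C * ε ^ 2) ≤ (1 + x ^ 2) ^ 4 * (C * ε ^ 2) :=
    mul_le_mul_of_nonneg_right hqx hCe
  have hn : 0 ≤ (1 + x ^ 2) ^ 4 * (C * ε ^ 2) := by positivity
  linarith

end IsConcentratedAtOne

/-! ### Approximation of the divergence integrand and its integral. -/

/-- The approximation of `klFun` of the mixture density whose integral is computed exactly. -/
noncomputable def klApprox (μ : Measure ℝ) (ε x : ℝ) : ℝ :=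
  (ε / 8 * hermiteFour x) ^ 2 / 2 + ε / 8 * hermiteFour x * mixtureRemainder μ ε x
    - (ε / 8 * hermiteFour x) ^ 3 / 6

lemma abs_hermiteFour_le (x : ℝ) : |hermiteFour x| ≤ 8 * (1 + x ^ 2) ^ 2 := by
  rw [hermiteFour, abs_le]
  constructor <;> nlinarith [sq_nonneg x, sq_nonneg (x ^ 2)]

/-- With `r = 1 + g + k`, the error consists of the quartic remainder of `klFun`, `k² / 2`, and the
cubic terms containing `k`. In units of `ε⁴ (B P⁴)⁴` these cost `256`, `1 / 2` and `7 / 6`, below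
`258` in total. -/
lemma abs_klFun_sub_klApprox_le_of_small {μ : Measure ℝ} {ε B P x : ℝ} (hε : 0 < ε)
    (hε1 : ε ≤ 1) (hB : 1 ≤ B) (hP : 1 ≤ P) (hg : |hermiteFour x| ≤ 8 * P ^ 2)
    (hr : |mixtureRemainder μ ε x| ≤ B * ε ^ 2 * P ^ 4) :
    |InformationTheory.klFun (mixtureDensity μ x) - klApprox μ ε x| ≤
      258 * B ^ 4 * ε ^ 4 * P ^ 16 := by
  set v := B * P ^ 4 with hv
  set g := ε / 8 * hermiteFour x with hgdef
  set k := mixtureRemainder μ ε x with hk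
  have hv1 : 1 ≤ v := by
    have := one_le_pow₀ hP (n := 4)
    nlinarith
  have hP24 : P ^ 2 ≤ P ^ 4 := pow_le_pow_right₀ hP (by norm_num)
  have hP24' : P ^ 4 ≤ v := by
    have : 0 ≤ P ^ 4 := by positivity
    nlinarith
  have hgv : |g| ≤ ε * v := by
    rw [hgdef, abs_mul, abs_of_pos (by positivity : 0 < ε / 8)]
    calc ε / 8 * |hermiteFour x| ≤ ε / 8 * (8 * v) :=
          mul_le_mul_of_nonneg_left (by linarith) (by positivity)
      _ = ε * v := by ring
  have hkv : |k| ≤ ε ^ 2 * v := by rw [hv]; linarith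
  have hε2 : ε ^ 2 ≤ ε := by nlinarith
  have hkv' : |k| ≤ ε * v := hkv.trans (mul_le_mul_of_nonneg_right hε2 (by linarith))
  have hden : mixtureDensity μ x = 1 + (g + k) := by
    rw [hk, mixtureRemainder, hgdef]; ring
  have hge : -1 ≤ g + k := by
    have := mixtureDensity_nonneg μ x
    linarith
  have h1 := abs_klFun_one_add_sub_le hge
  have h2 : (g + k) ^ 4 ≤ 16 * (ε ^ 4 * v ^ 4) := by
    have h : |g + k| ≤ 2 * (ε * v) := (abs_add_le _ _).trans (by linarith)
    have := pow_le_pow_left₀ (abs_nonneg _) h 4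
    rw [pow_abs, abs_of_nonneg (by positivity)] at this
    calc (g + k) ^ 4 ≤ _ := this
      _ = _ := by ring
  have hkk : |k ^ 2 / 2| ≤ ε ^ 4 * v ^ 4 / 2 := by
    rw [abs_div, abs_pow, abs_two]
    have := pow_le_pow_left₀ (abs_nonneg _) hkv 2
    have hvv : v ^ 2 ≤ v ^ 4 := pow_le_pow_right₀ hv1 (by norm_num)
    have : |k| ^ 2 ≤ ε ^ 4 * v ^ 4 := this.trans (by
      calc (ε ^ 2 * v) ^ 2 = ε ^ 4 * v ^ 2 := by ring
        _ ≤ ε ^ 4 * v ^ 4 := mul_le_mul_of_nonneg_left hvv (by positivity))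
    linarith
  have hcub : |k * (3 * g ^ 2 + 3 * (g * k) + k ^ 2) / 6| ≤ 7 / 6 * (ε ^ 4 * v ^ 4) := by
    have hvv : v ^ 3 ≤ v ^ 4 := pow_le_pow_right₀ hv1 (by norm_num)
    have a1 : |3 * g ^ 2 + 3 * (g * k) + k ^ 2| ≤ 7 * (ε * v) ^ 2 := by
      have b1 : |g ^ 2| ≤ (ε * v) ^ 2 := by
        rw [abs_pow]; exact pow_le_pow_left₀ (abs_nonneg _) hgv 2
      have b2 : |k ^ 2| ≤ (ε * v) ^ 2 := by
        rw [abs_pow]; exact pow_le_pow_left₀ (abs_nonneg _) hkv' 2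
      have b3 : |g * k| ≤ (ε * v) ^ 2 := by
        rw [abs_mul, sq]; exact mul_le_mul hgv hkv' (abs_nonneg _) (by positivity)
      rw [abs_le] at *
      constructor <;> linarith [b1.1, b1.2, b2.1, b2.2, b3.1, b3.2]
    rw [abs_div, abs_mul, abs_of_pos (by norm_num : (0 : ℝ) < 6)]
    have a2 := mul_le_mul hkv a1 (abs_nonneg _) (by positivity)
    have a3 : ε ^ 2 * v * (7 * (ε * v) ^ 2) = 7 * (ε ^ 4 * v ^ 3) := by ring
    have a4 : ε ^ 4 * v ^ 3 ≤ ε ^ 4 * v ^ 4 := mul_le_mul_of_nonneg_left hvv (by positivity)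
    linarith
  have hid : InformationTheory.klFun (mixtureDensity μ x) - klApprox μ ε x =
      (InformationTheory.klFun (1 + (g + k)) - ((g + k) ^ 2 / 2 - (g + k) ^ 3 / 6))
      + (k ^ 2 / 2 - k * (3 * g ^ 2 + 3 * (g * k) + k ^ 2) / 6) := by
    rw [hden, klApprox, ← hgdef, ← hk]; ring
  have hvp : B ^ 4 * P ^ 16 = v ^ 4 := by rw [hv]; ring
  have hfin : 258 * B ^ 4 * ε ^ 4 * P ^ 16 = 258 * (ε ^ 4 * v ^ 4) := by rw [← hvp]; ring
  rw [hid, hfin]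
  refine (abs_add_le _ _).trans ?_
  have hnn : 0 ≤ ε ^ 4 * v ^ 4 := by positivity
  have := abs_sub (k ^ 2 / 2) (k * (3 * g ^ 2 + 3 * (g * k) + k ^ 2) / 6)
  linarith

lemma abs_klFun_sub_klApprox_le_of_large {μ : Measure ℝ} {ε C P x : ℝ} (hε : 0 < ε)
    (hε1 : ε ≤ 1) (hC : 1 ≤ C) (hP : 1 ≤ P) (hPx : x ^ 2 / 2 + 1 ≤ P)
    (hg : |hermiteFour x| ≤ 8 * P ^ 2)
    (hr : mixtureDensity μ x ≤ Real.exp (x ^ 2 / 2) * (1 + C)) :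
    |InformationTheory.klFun (mixtureDensity μ x) - klApprox μ ε x| ≤
      (C + 5) * (1 + mixtureDensity μ x) * P ^ 6 := by
  set r := mixtureDensity μ x with hrdef
  set g := ε / 8 * hermiteFour x with hgdef
  have hr0 : 0 ≤ r := mixtureDensity_nonneg μ x
  have hgP : |g| ≤ P ^ 2 := by
    rw [hgdef, abs_mul, abs_of_pos (by positivity : 0 < ε / 8)]
    calc ε / 8 * |hermiteFour x| ≤ 1 / 8 * (8 * P ^ 2) :=
          mul_le_mul (by linarith) hg (abs_nonneg _) (by norm_num)
      _ = P ^ 2 := by ring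
  have hkl : |InformationTheory.klFun r| ≤ (C + 1) * (1 + r) * P := by
    rw [abs_of_nonneg (InformationTheory.klFun_nonneg hr0), InformationTheory.klFun_apply]
    have hlog : r * Real.log r ≤ r * (x ^ 2 / 2 + C) := by
      rcases hr0.eq_or_lt with h0 | h0
      · simp [← h0]
      · refine mul_le_mul_of_nonneg_left ?_ hr0
        have h1 := Real.log_le_log h0 hr
        rw [Real.log_mul (Real.exp_pos _).ne' (by positivity), Real.log_exp] at h1
        have := Real.log_le_sub_one_of_pos (by positivity : 0 < 1 + C)
        linarith
    have a1 : x ^ 2 / 2 + C ≤ (C + 1) * P := by nlinarith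
    have a2 := mul_le_mul_of_nonneg_left a1 hr0
    have a3 : 1 ≤ (C + 1) * P := by nlinarith
    nlinarith
  have hk : |mixtureRemainder μ ε x| ≤ (1 + r) + P ^ 2 := by
    rw [mixtureRemainder, ← hrdef, ← hgdef]
    rw [abs_le] at hgP ⊢
    constructor <;> linarith [hgP.1, hgP.2]
  have hP1 : P ≤ P ^ 6 := le_self_pow₀ hP (by norm_num)
  have hP2 : P ^ 2 ≤ P ^ 6 := pow_le_pow_right₀ hP (by norm_num)
  have hP4 : P ^ 4 ≤ P ^ 6 := pow_le_pow_right₀ hP (by norm_num)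
  have hP0 : 0 ≤ P ^ 6 := by positivity
  have b1 : |g ^ 2 / 2| ≤ P ^ 6 / 2 := by
    rw [abs_div, abs_pow, abs_two]
    have := pow_le_pow_left₀ (abs_nonneg _) hgP 2
    norm_num only [← pow_mul] at this
    linarith
  have b2 : |g ^ 3 / 6| ≤ P ^ 6 / 6 := by
    rw [abs_div, abs_pow, abs_of_pos (by norm_num : (0 : ℝ) < 6)]
    have := pow_le_pow_left₀ (abs_nonneg _) hgP 3
    norm_num only [← pow_mul] at this
    linarith
  have b3 : |g * mixtureRemainder μ ε x| ≤ (1 + r) * P ^ 6 + P ^ 6 := by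
    rw [abs_mul]
    have := mul_le_mul hgP hk (abs_nonneg _) (by positivity)
    have e : P ^ 2 * ((1 + r) + P ^ 2) = (1 + r) * P ^ 2 + P ^ 4 := by ring
    have := mul_le_mul_of_nonneg_left hP2 (by linarith : 0 ≤ 1 + r)
    linarith
  have b4 : |klApprox μ ε x| ≤ 3 * ((1 + r) * P ^ 6) := by
    have h1 : P ^ 6 ≤ (1 + r) * P ^ 6 := by nlinarith
    rw [klApprox, ← hgdef]
    refine (abs_sub _ _).trans ?_
    have := abs_add_le (g ^ 2 / 2) (g * mixtureRemainder μ ε x)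
    linarith
  refine (abs_sub _ _).trans ?_
  have c1 : (C + 1) * (1 + r) * P ≤ (C + 1) * (1 + r) * P ^ 6 :=
    mul_le_mul_of_nonneg_left hP1 (by positivity)
  have c2 : 0 ≤ (1 + r) * P ^ 6 := by positivity
  linarith

namespace IsConcentratedAtOne

variable {ε C : ℝ} {μ : Measure ℝ}

/-- If `ε x⁴ > 1`, then `1 ≤ ε P²`, so `P⁶ ≤ ε⁴ P¹⁶` and the crude bound is itself of order `ε⁴`.
The factor `1 + r` makes the majorant a sum of a moment of the Gaussian and a moment of the mixture.
-/
lemma abs_klFun_sub_klApprox_le [IsProbabilityMeasure μ] (h : IsConcentratedAtOne ε C μ)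
    (hε : 0 < ε) (hε1 : ε ≤ 1) (x : ℝ) :
    |InformationTheory.klFun (mixtureDensity μ x) - klApprox μ ε x| ≤
      (258 * (3000000 * C) ^ 4 + C + 5) * ε ^ 4 *
        ((1 + mixtureDensity μ x) * (1 + x ^ 2) ^ 16) := by
  have hC := h.one_le
  have hr0 := mixtureDensity_nonneg μ x
  have hP : 1 ≤ 1 + x ^ 2 := by linarith [sq_nonneg x]
  set P := 1 + x ^ 2 with hPdef
  set r := mixtureDensity μ x
  have hPr : 0 ≤ r * P ^ 16 := by positivity
  have hP0 : 0 ≤ P ^ 16 := by positivity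
  rcases le_or_gt (ε * x ^ 4) 1 with hx | hx
  · refine (abs_klFun_sub_klApprox_le_of_small hε hε1 (by linarith : 1 ≤ 3000000 * C) hP
      (abs_hermiteFour_le x) (h.abs_mixtureRemainder_le hε hε1 hx)).trans ?_
    have e1 : (258 * (3000000 * C) ^ 4) * ε ^ 4 * P ^ 16 ≤
        (258 * (3000000 * C) ^ 4 + C + 5) * ε ^ 4 * ((1 + r) * P ^ 16) := by
      gcongr
      · linarith
      · linarith
    linarith
  · refine (abs_klFun_sub_klApprox_le_of_large hε hε1 hC hP
      (by rw [hPdef]; linarith [sq_nonneg x]) (abs_hermiteFour_le x)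
      (h.mixtureDensity_le x)).trans ?_
    have hx4 : x ^ 4 ≤ P ^ 2 := by rw [hPdef]; nlinarith [sq_nonneg x]
    have e1 : 1 ≤ ε * P ^ 2 := hx.le.trans (mul_le_mul_of_nonneg_left hx4 hε.le)
    have e2 : 1 ≤ ε ^ 4 * P ^ 8 := by
      have := one_le_pow₀ e1 (n := 4)
      calc (1 : ℝ) ≤ _ := this
        _ = _ := by ring
    have e3 : P ^ 6 ≤ ε ^ 4 * P ^ 16 := by
      have e4 : P ^ 6 ≤ P ^ 8 := pow_le_pow_right₀ hP (by norm_num)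
      calc P ^ 6 ≤ 1 * P ^ 8 := by linarith
        _ ≤ ε ^ 4 * P ^ 8 * P ^ 8 := mul_le_mul_of_nonneg_right e2 (by positivity)
        _ = _ := by ring
    calc (C + 5) * (1 + r) * P ^ 6 ≤ (C + 5) * (1 + r) * (ε ^ 4 * P ^ 16) := by gcongr
      _ = (C + 5) * ε ^ 4 * ((1 + r) * P ^ 16) := by ring
      _ ≤ _ := by
        gcongr
        have : 0 ≤ 258 * (3000000 * C) ^ 4 := by positivity
        linarith

end IsConcentratedAtOne

lemma integrable_hermiteFour_pow (n : ℕ) (ν : Measure ℝ)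
    (h : Integrable (fun x : ℝ => (1 + x ^ 2) ^ (2 * n)) ν) :
    Integrable (fun x => hermiteFour x ^ n) ν := by
  refine (h.const_mul (8 ^ n)).mono' (by unfold hermiteFour; fun_prop) (ae_of_all _ fun x => ?_)
  rw [norm_pow, Real.norm_eq_abs, pow_mul, ← mul_pow]
  exact pow_le_pow_left₀ (abs_nonneg _) (abs_hermiteFour_le x) n

namespace IsConcentratedAtOne

variable {ε C : ℝ} {μ : Measure ℝ}

/-- Substituting `k = r - 1 - g` leaves only powers of `hermiteFour` under the Gaussian and `r *
hermiteFour`, whose integral is the mixture mean of `hermiteFour`; no asymptotics enter. -/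
lemma integral_klApprox [IsProbabilityMeasure μ] (h : IsConcentratedAtOne ε C μ) (hε1 : ε ≤ 1) :
    Integrable (klApprox μ ε) (gaussianReal 0 1) ∧
      ∫ x, klApprox μ ε x ∂gaussianReal 0 1 = 3 / 16 * ε ^ 2 - 9 / 16 * ε ^ 3 := by
  have i : ∀ n, Integrable (fun x => hermiteFour x ^ n) (gaussianReal 0 1) := fun n =>
    integrable_hermiteFour_pow n _ (integrable_one_add_sq_pow_gaussianReal _)
  have i1 : Integrable hermiteFour (gaussianReal 0 1) := by simpa using i 1
  have iV : Integrable hermiteFour (varianceMixture μ) := by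
    simpa using integrable_hermiteFour_pow 1 _ (h.integrable_varianceMixture hε1 2).1
  have ir := h.integrable_mixtureDensity_mul iV
  have e : klApprox μ ε = fun x => ε / 8 * (mixtureDensity μ x * hermiteFour x)
      - ε / 8 * hermiteFour x - ε ^ 2 / 128 * hermiteFour x ^ 2
      - ε ^ 3 / 3072 * hermiteFour x ^ 3 := by
    ext x
    rw [klApprox, mixtureRemainder]
    ring
  have j1 := (ir.const_mul (ε / 8)).sub' (i1.const_mul (ε / 8))
  have j2 := j1.sub' ((i 2).const_mul (ε ^ 2 / 128))
  have j3 := j2.sub' ((i 3).const_mul (ε ^ 3 / 3072))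
  rw [e]
  refine ⟨j3, ?_⟩
  rw [integral_sub j2 ((i 3).const_mul (ε ^ 3 / 3072)),
    integral_sub j1 ((i 2).const_mul (ε ^ 2 / 128)),
    integral_sub (ir.const_mul (ε / 8)) (i1.const_mul (ε / 8))]
  simp only [integral_const_mul, h.integral_mixtureDensity_mul,
    h.integral_hermiteFour_varianceMixture hε1, integral_hermiteFour, integral_hermiteFour_sq,
    integral_hermiteFour_cube]
  ring

lemma integral_klFun [IsProbabilityMeasure μ] (h : IsConcentratedAtOne ε C μ)
    (hε : 0 < ε) (hε1 : ε ≤ 1) :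
    Integrable (fun x => InformationTheory.klFun (mixtureDensity μ x)) (gaussianReal 0 1) ∧
      |∫ x, InformationTheory.klFun (mixtureDensity μ x) ∂gaussianReal 0 1
        - (3 / 16 * ε ^ 2 - 9 / 16 * ε ^ 3)| ≤
      (258 * (3000000 * C) ^ 4 + C + 5) * ε ^ 4 *
        ((1 + (Nat.factorial 16 : ℝ) * Real.exp 2 * C) *
          ∫ y, (1 + y ^ 2) ^ 16 ∂gaussianReal 0 1) := by
  obtain ⟨iQ, hQ⟩ := h.integral_klApprox hε1
  have hV := h.integrable_varianceMixture hε1 16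
  have iG := integrable_one_add_sq_pow_gaussianReal 16
  have ir := h.integrable_mixtureDensity_mul hV.1
  have ibd := iG.fun_add ir
  have e : ∀ x : ℝ, (1 + mixtureDensity μ x) * (1 + x ^ 2) ^ 16 =
      (1 + x ^ 2) ^ 16 + mixtureDensity μ x * (1 + x ^ 2) ^ 16 := fun x => by ring
  have hC := h.one_le
  have hmeas : Measurable fun x => InformationTheory.klFun (mixtureDensity μ x) :=
    InformationTheory.measurable_klFun.comp (measurable_mixtureDensity μ)
  have hbd : ∀ᵐ x ∂gaussianReal 0 1,
      ‖InformationTheory.klFun (mixtureDensity μ x) - klApprox μ ε x‖ ≤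
      (258 * (3000000 * C) ^ 4 + C + 5) * ε ^ 4 *
        ((1 + x ^ 2) ^ 16 + mixtureDensity μ x * (1 + x ^ 2) ^ 16) :=
    ae_of_all _ fun x => by
      rw [← e]; exact h.abs_klFun_sub_klApprox_le hε hε1 x
  have ibd' := ibd.const_mul ((258 * (3000000 * C) ^ 4 + C + 5) * ε ^ 4)
  have idiff : Integrable
      (fun x => InformationTheory.klFun (mixtureDensity μ x) - klApprox μ ε x)
      (gaussianReal 0 1) :=
    ibd'.mono' (hmeas.aestronglyMeasurable.sub iQ.aestronglyMeasurable) hbd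
  have ikl : Integrable (fun x => InformationTheory.klFun (mixtureDensity μ x))
      (gaussianReal 0 1) := by
    have := idiff.fun_add iQ
    simpa using this
  refine ⟨ikl, ?_⟩
  rw [← hQ, ← integral_sub ikl iQ]
  refine (norm_integral_le_of_norm_le ibd' hbd).trans ?_
  rw [integral_const_mul, integral_add iG ir, h.integral_mixtureDensity_mul]
  refine mul_le_mul_of_nonneg_left ?_ (by positivity)
  linarith [hV.2]

/-- The expansion of the Kullback–Leibler divergence of a Gaussian variance mixture from the
standard Gaussian, uniformly in the mixing distribution. -/
theorem klDiv_varianceMixture [IsProbabilityMeasure μ] (h : IsConcentratedAtOne ε C μ)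
    (hε : 0 < ε) (hε1 : ε ≤ 1) :
    InformationTheory.klDiv (varianceMixture μ) (gaussianReal 0 1) ≠ ⊤ ∧
      |(InformationTheory.klDiv (varianceMixture μ) (gaussianReal 0 1)).toReal
        - (3 / 16 * ε ^ 2 - 9 / 16 * ε ^ 3)| ≤
      (258 * (3000000 * C) ^ 4 + C + 5) *
        ((1 + (Nat.factorial 16 : ℝ) * Real.exp 2 * C) *
          ∫ y, (1 + y ^ 2) ^ 16 ∂gaussianReal 0 1) * ε ^ 4 := by
  obtain ⟨ikl, hkl⟩ := h.integral_klFun hε hε1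
  have hac : varianceMixture μ ≪ gaussianReal 0 1 := by
    rw [h.varianceMixture_eq]; exact withDensity_absolutelyContinuous _ _
  have hrn : (varianceMixture μ).rnDeriv (gaussianReal 0 1) =ᵐ[gaussianReal 0 1]
      fun x => ENNReal.ofReal (mixtureDensity μ x) := by
    have := Measure.rnDeriv_withDensity (gaussianReal 0 1)
      (measurable_mixtureDensity μ).ennreal_ofReal
    rwa [← h.varianceMixture_eq] at this
  have hcongr : (fun x => InformationTheory.klFun
      ((varianceMixture μ).rnDeriv (gaussianReal 0 1) x).toReal) =ᵐ[gaussianReal 0 1]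
      fun x => InformationTheory.klFun (mixtureDensity μ x) := by
    filter_upwards [hrn] with x hx
    rw [hx, ENNReal.toReal_ofReal (mixtureDensity_nonneg μ x)]
  constructor
  · refine InformationTheory.klDiv_ne_top hac ?_
    rw [← InformationTheory.integrable_klFun_rnDeriv_iff hac]
    exact (integrable_congr hcongr).mpr ikl
  · rw [InformationTheory.toReal_klDiv_eq_integral_klFun hac, integral_congr_ae hcongr]
    refine hkl.trans (le_of_eq (by ring))

end IsConcentratedAtOne

/-! ### Integrals against densities on the half-line, and moments from the cumulant function. -/

lemma withDensity_eq_restrict_Ioi {f : ℝ → ℝ} (hneg : ∀ x < 0, f x = 0) :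
    volume.withDensity (fun x => ENNReal.ofReal (f x)) =
      (volume.restrict (Set.Ioi 0)).withDensity fun x => ENNReal.ofReal (f x) := by
  rw [← withDensity_indicator measurableSet_Ioi]
  refine withDensity_congr_ae ?_
  have h0 : ∀ᵐ x : ℝ, x ≠ 0 := by simp [ae_iff]
  filter_upwards [h0] with x hx
  rcases lt_or_gt_of_ne hx with h | h
  · rw [Set.indicator_of_notMem (by simpa using h.le), hneg x h, ENNReal.ofReal_zero]
  · rw [Set.indicator_of_mem (by simpa using h)]

lemma ae_pos_withDensity {f : ℝ → ℝ} (hneg : ∀ x < 0, f x = 0) :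
    ∀ᵐ x ∂volume.withDensity (fun x => ENNReal.ofReal (f x)), 0 < x := by
  rw [withDensity_eq_restrict_Ioi hneg]
  exact (withDensity_absolutelyContinuous _ _).ae_le (ae_restrict_mem measurableSet_Ioi)

/-- Integrability comes for free from `I ≠ 0`: the Bochner integral of a non-integrable function is
`0`. -/
lemma integrable_withDensity_and_integral {f G : ℝ → ℝ} {I : ℝ} (hf : Measurable f)
    (h0 : ∀ x, 0 ≤ f x) (hneg : ∀ x < 0, f x = 0) (hI : I ≠ 0)
    (h : ∫ x in Set.Ioi 0, f x * G x = I) :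
    Integrable G (volume.withDensity fun x => ENNReal.ofReal (f x)) ∧
      ∫ x, G x ∂volume.withDensity (fun x => ENNReal.ofReal (f x)) = I := by
  rw [withDensity_eq_restrict_Ioi hneg,
    integrable_withDensity_iff_integrable_smul' hf.ennreal_ofReal
      (ae_of_all _ fun _ => ENNReal.ofReal_lt_top),
    integral_withDensity_eq_integral_toReal_smul hf.ennreal_ofReal
      (ae_of_all _ fun _ => ENNReal.ofReal_lt_top)]
  simp only [ENNReal.toReal_ofReal (h0 _), smul_eq_mul]
  exact ⟨Integrable.of_integral_ne_zero (by rwa [h]), h⟩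

/-- Differentiating `exp ∘ c` three times at `0`: with vanishing mean, the second and third moments
are the second and third cumulants. -/
lemma moments_of_mgf_eq_exp {Ω : Type*} [MeasurableSpace Ω] {μ : Measure Ω} {X : Ω → ℝ} {δ : ℝ}
    (hδ : 0 < δ) {c c₁ c₂ : ℝ → ℝ} {c₃ : ℝ}
    (hint : ∀ t, |t| < δ → Integrable (fun ω => Real.exp (t * X ω)) μ)
    (hmgf : ∀ t, |t| < δ → ∫ ω, Real.exp (t * X ω) ∂μ = Real.exp (c t))
    (h1 : ∀ t, |t| < δ → HasDerivAt c (c₁ t) t) (h2 : ∀ t, |t| < δ → HasDerivAt c₁ (c₂ t) t)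
    (h3 : HasDerivAt c₂ c₃ 0) (hc : c 0 = 0) (hc₁ : c₁ 0 = 0) :
    ∫ ω, X ω ∂μ = 0 ∧ ∫ ω, X ω ^ 2 ∂μ = c₂ 0 ∧ ∫ ω, X ω ^ 3 ∂μ = c₃ := by
  let M : ℕ → ℝ → ℝ := fun n t => ∫ ω, X ω ^ n * Real.exp (t * X ω) ∂μ
  have hnhds : ∀ t, |t| < δ → ∀ᶠ u in 𝓝 t, |u| < δ := fun t ht =>
    continuous_abs.continuousAt.eventually_lt continuousAt_const ht
  have hM : ∀ n t, |t| < δ → HasDerivAt (M n) (M (n + 1) t) t := fun n t ht => by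
    refine hasDerivAt_integral_pow_mul_exp_real ?_ n
    exact mem_interior_iff_mem_nhds.mpr ((hnhds t ht).mono fun u hu => hint u hu)
  have e0 : ∀ t, |t| < δ → M 0 t = Real.exp (c t) := fun t ht => by
    simpa [M] using hmgf t ht
  have e1 : ∀ t, |t| < δ → M 1 t = c₁ t * Real.exp (c t) := fun t ht => by
    have h := (h1 t ht).exp.congr_of_eventuallyEq ((hnhds t ht).mono e0)
    rw [(hM 0 t ht).unique h, mul_comm]
  have e2 : ∀ t, |t| < δ → M 2 t = (c₂ t + c₁ t ^ 2) * Real.exp (c t) := fun t ht => by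
    have h := ((h2 t ht).mul (h1 t ht).exp).congr_of_eventuallyEq ((hnhds t ht).mono e1)
    rw [(hM 1 t ht).unique h]; ring
  have h00 : |(0 : ℝ)| < δ := by simpa using hδ
  have e3 : M 3 0 = c₃ := by
    have h := ((h3.add ((h2 0 h00).pow 2)).mul (h1 0 h00).exp).congr_of_eventuallyEq
      ((hnhds 0 h00).mono e2)
    rw [(hM 2 0 h00).unique h]
    simp [hc, hc₁]
  have f1 := e1 0 h00
  have f2 := e2 0 h00
  simp only [M, hc, hc₁, zero_mul, Real.exp_zero, mul_one, pow_one] at f1 f2 e3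
  exact ⟨f1, by simpa using f2, e3⟩

/-! ### The integral behind the inverse Gaussian normalisation. -/

/-- The antiderivative of `exp (-t ^ 2)` vanishing at `0`. -/
noncomputable def gaussianPrimitive (z : ℝ) : ℝ := ∫ t in (0 : ℝ)..z, Real.exp (-t ^ 2)

lemma hasDerivAt_gaussianPrimitive (z : ℝ) :
    HasDerivAt gaussianPrimitive (Real.exp (-z ^ 2)) z := by
  have hc : Continuous fun t : ℝ => Real.exp (-t ^ 2) := by fun_prop
  exact intervalIntegral.integral_hasDerivAt_right (hc.intervalIntegrable _ _)
    hc.stronglyMeasurable.stronglyMeasurableAtFilter hc.continuousAt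

lemma tendsto_gaussianPrimitive_atTop :
    Tendsto gaussianPrimitive atTop (𝓝 (√Real.pi / 2)) := by
  have h := integral_gaussian_Ioi 1
  have hi := (integrable_exp_neg_mul_sq one_pos).integrableOn (s := Set.Ioi (0 : ℝ))
  simp only [neg_mul, one_mul, div_one] at h hi
  rw [← h]
  exact intervalIntegral_tendsto_integral_Ioi 0 hi tendsto_id

lemma gaussianPrimitive_neg (z : ℝ) : gaussianPrimitive (-z) = -gaussianPrimitive z := by
  have h := intervalIntegral.integral_comp_neg (a := 0) (b := z)
    (f := fun t : ℝ => Real.exp (-t ^ 2))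
  simp only [neg_sq, neg_zero] at h
  rw [gaussianPrimitive, gaussianPrimitive, h, intervalIntegral.integral_symm]

lemma tendsto_gaussianPrimitive_atBot :
    Tendsto gaussianPrimitive atBot (𝓝 (-(√Real.pi / 2))) := by
  have h := (tendsto_gaussianPrimitive_atTop.comp tendsto_neg_atBot_atTop).neg
  refine h.congr fun z => ?_
  simp [gaussianPrimitive_neg]

/-- Since `(A√x ∓ B/√x)² = A²x + B²/x ∓ 2AB`, both terms of `H` have derivatives proportional to the
same exponential. In their difference the `A / √x` parts cancel and `B / (x√x)` remains. -/
lemma integral_inv_mul_sqrt_mul_exp {A B : ℝ} (hA : 0 < A) (hB : 0 < B) :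
    ∫ x in Set.Ioi 0, (x * √x)⁻¹ * Real.exp (-(A ^ 2 * x) - B ^ 2 / x) =
      √Real.pi / B * Real.exp (-(2 * A * B)) := by
  let H : ℝ → ℝ := fun x => Real.exp (-(2 * A * B)) * gaussianPrimitive (A * √x - B / √x)
    - Real.exp (2 * A * B) * gaussianPrimitive (A * √x + B / √x)
  have hs0 : Tendsto (fun x : ℝ => √x) (𝓝[>] 0) (𝓝[>] 0) := by
    refine tendsto_nhdsWithin_iff.mpr ⟨?_, ?_⟩
    · have h := (Real.continuous_sqrt.tendsto 0).mono_left
        (nhdsWithin_le_nhds (s := Set.Ioi 0))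
      simpa using h
    · filter_upwards [self_mem_nhdsWithin] with x hx using Real.sqrt_pos.mpr hx
  have hd0 : Tendsto (fun x : ℝ => B / √x) (𝓝[>] 0) atTop :=
    (tendsto_inv_nhdsGT_zero.comp hs0).const_mul_atTop hB
  have ha0 : Tendsto (fun x : ℝ => A * √x) (𝓝[>] 0) (𝓝 0) := by
    simpa using (hs0.mono_right nhdsWithin_le_nhds).const_mul A
  have hdT : Tendsto (fun x : ℝ => B / √x) atTop (𝓝 0) :=
    Real.tendsto_sqrt_atTop.const_div_atTop B
  have haT : Tendsto (fun x : ℝ => A * √x) atTop atTop :=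
    Real.tendsto_sqrt_atTop.const_mul_atTop hA
  have hm0 : Tendsto (fun x : ℝ => A * √x - B / √x) (𝓝[>] 0) atBot := by
    simp only [sub_eq_add_neg]
    exact ha0.add_atBot (tendsto_neg_atTop_atBot.comp hd0)
  have hp0 : Tendsto (fun x : ℝ => A * √x + B / √x) (𝓝[>] 0) atTop := ha0.add_atTop hd0
  have hmT : Tendsto (fun x : ℝ => A * √x - B / √x) atTop atTop := by
    simp only [sub_eq_add_neg]
    exact haT.atTop_add hdT.neg
  have hpT : Tendsto (fun x : ℝ => A * √x + B / √x) atTop atTop := haT.atTop_add hdT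
  have hH0 : Tendsto H (𝓝[>] 0) (𝓝 (Real.exp (-(2 * A * B)) * -(√Real.pi / 2)
      - Real.exp (2 * A * B) * (√Real.pi / 2))) :=
    ((tendsto_gaussianPrimitive_atBot.comp hm0).const_mul _).sub
      ((tendsto_gaussianPrimitive_atTop.comp hp0).const_mul _)
  have hHT : Tendsto H atTop (𝓝 (Real.exp (-(2 * A * B)) * (√Real.pi / 2)
      - Real.exp (2 * A * B) * (√Real.pi / 2))) :=
    ((tendsto_gaussianPrimitive_atTop.comp hmT).const_mul _).sub
      ((tendsto_gaussianPrimitive_atTop.comp hpT).const_mul _)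
  have hderiv : ∀ x ∈ Set.Ioi (0 : ℝ), HasDerivAt H
      (B * ((x * √x)⁻¹ * Real.exp (-(A ^ 2 * x) - B ^ 2 / x))) x := by
    intro x hx
    have hx : 0 < x := hx
    have hs : 0 < √x := Real.sqrt_pos.mpr hx
    have hsq : √x ^ 2 = x := Real.sq_sqrt hx.le
    have d1 := (Real.hasDerivAt_sqrt hx.ne').const_mul A
    have d2 := ((Real.hasDerivAt_sqrt hx.ne').fun_inv hs.ne').const_mul B
    have d3 := ((hasDerivAt_gaussianPrimitive _).comp x (d1.sub d2)).const_mul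
      (Real.exp (-(2 * A * B)))
    have d4 := ((hasDerivAt_gaussianPrimitive _).comp x (d1.add d2)).const_mul
      (Real.exp (2 * A * B))
    have e3 : Real.exp (-(2 * A * B)) * Real.exp (-(A * √x - B * (√x)⁻¹) ^ 2) =
        Real.exp (-(A ^ 2 * x) - B ^ 2 / x) * 1 := by
      rw [← Real.exp_add, mul_one]
      congr 1
      have : B ^ 2 / x = B ^ 2 * (√x)⁻¹ ^ 2 := by rw [inv_pow, hsq, div_eq_mul_inv]
      have h2 : A ^ 2 * x = A ^ 2 * √x ^ 2 := by rw [hsq]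
      rw [this, h2]
      field_simp
      ring
    have e4 : Real.exp (2 * A * B) * Real.exp (-(A * √x + B * (√x)⁻¹) ^ 2) =
        Real.exp (-(A ^ 2 * x) - B ^ 2 / x) * 1 := by
      rw [← Real.exp_add, mul_one]
      congr 1
      have : B ^ 2 / x = B ^ 2 * (√x)⁻¹ ^ 2 := by rw [inv_pow, hsq, div_eq_mul_inv]
      have h2 : A ^ 2 * x = A ^ 2 * √x ^ 2 := by rw [hsq]
      rw [this, h2]
      field_simp
      ring
    have d := d3.sub d4
    simp only [Pi.sub_apply, Pi.add_apply, ← mul_assoc, e3, e4] at d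
    convert! d using 1
    rw [hsq]
    field_simp
    ring
  -- `H 0` is `0` because division by zero gives `0`, which is not the limit from the right; `H` is
  -- redefined at `0` to be continuous there.
  have hint := integral_Ioi_of_hasDerivAt_of_nonneg (a := 0)
    (g := Function.update H 0 (Real.exp (-(2 * A * B)) * -(√Real.pi / 2)
      - Real.exp (2 * A * B) * (√Real.pi / 2)))
    (continuousWithinAt_update_same.mpr (by rwa [Set.Ici_sdiff_left]))
    (fun x hx => (hderiv x hx).congr_of_eventuallyEq
      ((lt_mem_nhds hx).mono fun y hy => Function.update_of_ne (ne_of_gt hy) _ _))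
    (fun x hx => by have : 0 < x := hx; positivity)
    (hHT.congr' ((eventually_gt_atTop 0).mono fun y hy =>
      (Function.update_of_ne (ne_of_gt hy) _ _).symm))
  rw [integral_const_mul, Function.update_self] at hint
  rw [div_mul_eq_mul_div, eq_div_iff hB.ne', mul_comm, hint]
  ring

/-! ### A concentration criterion from the cumulant generating function. -/

/-- A constant for which the rescaled mixing distributions are concentrated at `1`. -/
noncomputable def concentrationConst : ℝ := 16 * (Nat.factorial 18 : ℝ)

/-- The gamma inverse moments need only `2 ^ 18 = 262144`; the value `16 * 18!` is dictated by the
inverse Gaussian case. -/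
lemma le_concentrationConst : 300000 ≤ concentrationConst := by
  norm_num [concentrationConst, Nat.factorial]

lemma exp_two_le : Real.exp 2 ≤ 8 := by
  have h := Real.exp_one_lt_d9
  have e : Real.exp 2 = Real.exp 1 ^ 2 := by rw [← Real.exp_nat_mul]; norm_num
  rw [e]
  nlinarith [Real.exp_pos 1]

/-- Here `c` is the cumulant generating function of `w - 1`. If `ε s² ≤ 1`, then `(ε s)² ≤ ε ≤
1/36`, so `|ε s| ≤ 1/4` lies inside the domain of `c`, and `c s ≤ 2` bounds the exponential moment
by `exp 2`. -/
lemma isConcentratedAtOne_of_mgf {μ : Measure ℝ} {ε : ℝ} (hε : 0 < ε) (hε1 : ε ≤ 1 / 36)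
    {c c₁ c₂ : ℝ → ℝ} {c₃ : ℝ} (hpos : ∀ᵐ w ∂μ, 0 < w)
    (hint : ∀ s, 2 * ε * |s| < 1 → Integrable (fun w => Real.exp (s * (w - 1))) μ)
    (hmgf : ∀ s, 2 * ε * |s| < 1 → ∫ w, Real.exp (s * (w - 1)) ∂μ = Real.exp (c s))
    (h1 : ∀ s, 2 * ε * |s| < 1 → HasDerivAt c (c₁ s) s)
    (h2 : ∀ s, 2 * ε * |s| < 1 → HasDerivAt c₁ (c₂ s) s)
    (h3 : HasDerivAt c₂ c₃ 0) (hc : c 0 = 0) (hc₁ : c₁ 0 = 0) (hc₂ : c₂ 0 = ε)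
    (hc₃ : |c₃| ≤ 3 * ε ^ 2) (hle : ∀ s, |ε * s| ≤ 1 / 4 → c s ≤ 2 * (ε * s ^ 2))
    (hinv : Integrable (fun w : ℝ => w⁻¹ ^ 18) μ)
    (hinv' : ∫ w, w⁻¹ ^ 18 ∂μ ≤ concentrationConst) :
    IsConcentratedAtOne ε concentrationConst μ := by
  have hδ : ∀ s, |s| < 1 / (2 * ε) → 2 * ε * |s| < 1 := fun s hs => by
    rwa [lt_div_iff₀ (by positivity), mul_comm] at hs
  obtain ⟨m1, m2, m3⟩ := moments_of_mgf_eq_exp (X := fun w : ℝ => w - 1) (δ := 1 / (2 * ε))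
    (by positivity) (fun s hs => hint s (hδ s hs)) (fun s hs => hmgf s (hδ s hs))
    (fun s hs => h1 s (hδ s hs)) (fun s hs => h2 s (hδ s hs)) h3 hc hc₁
  have hs4 : ∀ s : ℝ, ε * s ^ 2 ≤ 1 → |ε * s| ≤ 1 / 4 := fun s hs => by
    refine abs_le_of_sq_le_sq ?_ (by norm_num)
    nlinarith
  have hs2 : ∀ s : ℝ, ε * s ^ 2 ≤ 1 → 2 * ε * |s| < 1 := fun s hs => by
    have := hs4 s hs
    rw [abs_mul, abs_of_pos hε] at this
    linarith
  have hC := le_concentrationConst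
  refine ⟨hpos, m1, m2.trans hc₂, ?_, fun s hs => hint s (hs2 s hs), fun s hs => ?_, hinv, hinv'⟩
  · rw [m3]
    exact hc₃.trans (mul_le_mul_of_nonneg_right (by linarith) (sq_nonneg ε))
  · rw [hmgf s (hs2 s hs)]
    have h := hle s (hs4 s hs)
    have := Real.exp_le_exp.mpr (h.trans (by linarith : 2 * (ε * s ^ 2) ≤ 2))
    linarith [exp_two_le]

/-! ### Gamma mixing (GAL). -/

lemma integral_gammaMeasure {a r p t : ℝ} (ha : 0 < a) (hr : 0 < r) (hp : 0 < a + p)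
    (ht : t < r) :
    Integrable (fun x => x ^ p * Real.exp (t * x)) (gammaMeasure a r) ∧
      ∫ x, x ^ p * Real.exp (t * x) ∂gammaMeasure a r =
        r ^ a / Real.Gamma a * ((1 / (r - t)) ^ (a + p) * Real.Gamma (a + p)) := by
  have hrt : 0 < r - t := by linarith
  have hG := Real.Gamma_pos_of_pos ha
  have hG' := Real.Gamma_pos_of_pos hp
  have hrt' : 0 < 1 / (r - t) := by positivity
  refine integrable_withDensity_and_integral (f := gammaPDFReal a r)
    (measurable_gammaPDFReal a r) (gammaPDFReal_nonneg ha hr)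
    (fun x hx => by rw [gammaPDFReal, if_neg (not_le.mpr hx)]) (by positivity) ?_
  rw [← Real.integral_rpow_mul_exp_neg_mul_Ioi hp hrt, ← integral_const_mul]
  refine setIntegral_congr_fun measurableSet_Ioi fun x hx => ?_
  have hx : 0 < x := hx
  have e1 : x ^ (a + p - 1) = x ^ (a - 1) * x ^ p := by
    rw [← Real.rpow_add hx]; congr 1; ring
  have e2 : Real.exp (-((r - t) * x)) = Real.exp (-(r * x)) * Real.exp (t * x) := by
    rw [← Real.exp_add]; congr 1; ring
  simp only [gammaPDFReal, if_pos hx.le, e1, e2]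
  ring

lemma pow_mul_Gamma_le {b : ℝ} (hb : 0 < b) (n : ℕ) :
    b ^ n * Real.Gamma b ≤ Real.Gamma (b + n) := by
  induction n with
  | zero => simp
  | succ n ih =>
    have hbn : 0 < b + n := by positivity
    have e : b + (n + 1 : ℕ) = b + n + 1 := by push_cast; ring
    rw [e, Real.Gamma_add_one hbn.ne', pow_succ']
    have hG := Real.Gamma_pos_of_pos hb
    have : (0 : ℝ) ≤ n := by positivity
    calc b * b ^ n * Real.Gamma b = b * (b ^ n * Real.Gamma b) := by ring
      _ ≤ (b + n) * Real.Gamma (b + n) :=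
        mul_le_mul (by linarith) ih (by positivity) hbn.le

lemma isConcentratedAtOne_gamma {η h : ℝ} (hη : 0 < η) (hh : 0 < h) (hε1 : η / h ≤ 1 / 36) :
    IsConcentratedAtOne (η / h) concentrationConst
      ((gammaMeasure (h / η) (1 / η)).map fun v => v / h) := by
  set ε := η / h with hεdef
  have hε : 0 < ε := by positivity
  have ha : 0 < h / η := by positivity
  have hr : 0 < 1 / η := by positivity
  have haε : h / η = 1 / ε := by rw [hεdef]; field_simp
  have hmeas : Measurable fun v : ℝ => v / h := by fun_prop
  have hpos : ∀ᵐ v ∂gammaMeasure (h / η) (1 / η), 0 < v :=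
    ae_pos_withDensity (f := gammaPDFReal (h / η) (1 / η))
      fun x hx => by rw [gammaPDFReal, if_neg (not_le.mpr hx)]
  have hst : ∀ s, 2 * ε * |s| < 1 → 0 < 1 - ε * s := fun s hs => by
    have h1 : ε * s ≤ ε * |s| := mul_le_mul_of_nonneg_left (le_abs_self s) hε.le
    have h2 : 0 ≤ ε * |s| := by positivity
    linarith
  have e : ∀ s v : ℝ, Real.exp (s * (v / h - 1)) =
      Real.exp (-s) * (v ^ (0 : ℝ) * Real.exp (s / h * v)) := fun s v => by
    rw [Real.rpow_zero, one_mul, ← Real.exp_add]; congr 1; ring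
  have hlt : ∀ s, 2 * ε * |s| < 1 → s / h < 1 / η := fun s hs => by
    have := hst s hs
    rw [hεdef] at this
    rw [div_lt_div_iff₀ hh hη]
    have e2 : 1 - η / h * s = (h - η * s) / h := by field_simp
    rw [e2] at this
    have := (div_pos_iff_of_pos_right hh).mp this
    linarith
  have key : ∀ s, 2 * ε * |s| < 1 →
      Integrable (fun v => Real.exp (s * (v / h - 1))) (gammaMeasure (h / η) (1 / η)) ∧
      ∫ v, Real.exp (s * (v / h - 1)) ∂gammaMeasure (h / η) (1 / η) =
        Real.exp (-Real.log (1 - ε * s) / ε - s) := fun s hs => by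
    obtain ⟨i1, i2⟩ := integral_gammaMeasure (p := 0) ha hr (by simpa using ha) (hlt s hs)
    simp only [e]
    refine ⟨i1.const_mul _, ?_⟩
    have hG := (Real.Gamma_pos_of_pos ha).ne'
    have hst' := hst s hs
    have hl := hlt s hs
    rw [integral_const_mul, i2, add_zero]
    have e3 : (1 / η) ^ (h / η) / Real.Gamma (h / η) *
        ((1 / (1 / η - s / h)) ^ (h / η) * Real.Gamma (h / η)) =
        (1 / η * (1 / (1 / η - s / h))) ^ (h / η) := by
      rw [Real.mul_rpow hr.le (by have : 0 < 1 / η - s / h := by linarith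
                                  positivity)]
      field_simp
    have e4 : 1 / η * (1 / (1 / η - s / h)) = (1 - ε * s)⁻¹ := by
      have : 1 / η - s / h = (1 - ε * s) / η := by rw [hεdef]; field_simp
      rw [this]
      field_simp
    rw [e3, e4, Real.rpow_def_of_pos (by positivity), ← Real.exp_add, Real.log_inv, haε]
    congr 1
    ring
  have hinv : Integrable (fun v : ℝ => (v / h)⁻¹ ^ 18) (gammaMeasure (h / η) (1 / η)) ∧
      ∫ v, (v / h)⁻¹ ^ 18 ∂gammaMeasure (h / η) (1 / η) ≤ concentrationConst := by
    -- Shape at least `36 = 2 * 18` makes the shifted shape `b = h / η - 18` at least half of `h /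
    -- η`; this gives the factor `2 ^ 18`.
    have h36 : 36 ≤ h / η := by
      rw [haε, le_div_iff₀ hε]; linarith
    have hp : 0 < h / η + (-18) := by linarith
    obtain ⟨i1, i2⟩ := integral_gammaMeasure (p := -18) (t := 0) ha hr hp hr
    have e1 : (fun v : ℝ => (v / h)⁻¹ ^ 18) =ᵐ[gammaMeasure (h / η) (1 / η)]
        fun v => h ^ 18 * (v ^ (-18 : ℝ) * Real.exp (0 * v)) := by
      filter_upwards [hpos] with v hv
      have : v ^ (-18 : ℝ) = (v ^ 18)⁻¹ := by
        rw [Real.rpow_neg hv.le]; norm_cast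
      rw [this, inv_div, div_pow, zero_mul, Real.exp_zero, mul_one, div_eq_mul_inv]
    rw [integrable_congr e1, integral_congr_ae e1, integral_const_mul, i2]
    refine ⟨i1.const_mul _, ?_⟩
    set b := h / η + -18 with hb
    have hab : h / η = b + (18 : ℕ) := by rw [hb]; push_cast; ring
    have hGb := Real.Gamma_pos_of_pos hp
    have hGa := Real.Gamma_pos_of_pos ha
    have hG := pow_mul_Gamma_le hp 18
    rw [← hab] at hG
    have e2 : (1 / η) ^ (h / η) * (1 / (1 / η - 0)) ^ b = (1 / η) ^ 18 := by
      rw [sub_zero, one_div (1 / η), Real.inv_rpow hr.le, ← Real.rpow_neg hr.le,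
        ← Real.rpow_add hr, hb]
      norm_num
    have e3 : h ^ 18 * ((1 / η) ^ (h / η) / Real.Gamma (h / η) *
        ((1 / (1 / η - 0)) ^ b * Real.Gamma b)) =
        (h / η) ^ 18 * Real.Gamma b / Real.Gamma (h / η) := by
      calc _ = h ^ 18 * ((1 / η) ^ (h / η) * (1 / (1 / η - 0)) ^ b) * Real.Gamma b
            / Real.Gamma (h / η) := by ring
        _ = _ := by rw [e2]; ring
    have e4 : (h / η) ^ 18 ≤ 2 ^ 18 * b ^ 18 := by
      rw [← mul_pow]
      exact pow_le_pow_left₀ ha.le (by linarith) 18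
    rw [e3, div_le_iff₀ hGa]
    have hC := le_concentrationConst
    calc (h / η) ^ 18 * Real.Gamma b ≤ 2 ^ 18 * b ^ 18 * Real.Gamma b :=
          mul_le_mul_of_nonneg_right e4 hGb.le
      _ = 2 ^ 18 * (b ^ 18 * Real.Gamma b) := by ring
      _ ≤ concentrationConst * Real.Gamma (h / η) :=
          mul_le_mul (by norm_num; linarith) hG (by positivity) (by linarith)
  refine isConcentratedAtOne_of_mgf hε hε1
    (c := fun s => -Real.log (1 - ε * s) / ε - s)
    (c₁ := fun s => (1 - ε * s)⁻¹ - 1) (c₂ := fun s => ε * ((1 - ε * s) ^ 2)⁻¹)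
    (c₃ := 2 * ε ^ 2) ?_ (fun s hs => ?_) (fun s hs => ?_) (fun s hs => ?_) (fun s hs => ?_)
    ?_ (by simp) (by simp) (by simp) ?_ (fun s hs => ?_) ?_ ?_
  · rw [ae_map_iff hmeas.aemeasurable measurableSet_Ioi]
    filter_upwards [hpos] with v hv using div_pos hv hh
  · exact (integrable_map_measure (by fun_prop) hmeas.aemeasurable).mpr (key s hs).1
  · rw [integral_map hmeas.aemeasurable (by fun_prop)]
    exact (key s hs).2
  · have h1 := (hst s hs).ne'
    have d := (((((hasDerivAt_id s).const_mul ε).const_sub 1).log h1).neg.div_const ε).sub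
      (hasDerivAt_id s)
    convert! d using 1
    simp only [id]
    field_simp
  · have h1 := (hst s hs).ne'
    have d := ((((hasDerivAt_id s).const_mul ε).const_sub 1).fun_inv h1).sub_const 1
    convert! d using 1
    simp only [id]
    field_simp
  · have d := (((((hasDerivAt_id (0 : ℝ)).const_mul ε).const_sub 1).fun_pow 2).fun_inv
      (by simp)).const_mul ε
    convert! d using 1
    simp
    ring
  · rw [abs_of_nonneg (by positivity)]
    nlinarith [sq_nonneg ε]
  · obtain ⟨hs1, hs2⟩ := abs_le.mp hs
    have h1 : 0 < 1 - ε * s := by linarith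
    have h2 := Real.one_sub_inv_le_log_of_pos h1
    have h3 : -Real.log (1 - ε * s) ≤ ε * s + 2 * (ε * s) ^ 2 := by
      have : (1 - ε * s)⁻¹ - 1 ≤ ε * s + 2 * (ε * s) ^ 2 := by
        rw [sub_le_iff_le_add, inv_le_iff_one_le_mul₀ h1]
        nlinarith [mul_nonneg (sq_nonneg (ε * s)) (by linarith : 0 ≤ 1 - 2 * (ε * s))]
      linarith
    have h4 := div_le_div_of_nonneg_right h3 hε.le
    have h5 : (ε * s + 2 * (ε * s) ^ 2) / ε = s + 2 * (ε * s ^ 2) := by field_simp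
    linarith
  · exact (integrable_map_measure (by fun_prop) hmeas.aemeasurable).mpr hinv.1
  · rw [integral_map hmeas.aemeasurable (by fun_prop)]
    exact hinv.2

/-! ### Inverse Gaussian mixing (NIG). -/

lemma measurable_inverseGaussianPDFReal (m lam : ℝ) :
    Measurable (inverseGaussianPDFReal m lam) := by
  unfold inverseGaussianPDFReal
  exact Measurable.ite measurableSet_Ioi (by fun_prop) measurable_const

lemma inverseGaussianPDFReal_nonneg (m lam x : ℝ) : 0 ≤ inverseGaussianPDFReal m lam x := by
  unfold inverseGaussianPDFReal
  split_ifs <;> positivity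

lemma inverseGaussianPDFReal_of_neg (m lam : ℝ) {x : ℝ} (hx : x < 0) :
    inverseGaussianPDFReal m lam x = 0 := by
  rw [inverseGaussianPDFReal, if_neg (not_lt.mpr hx.le)]

/-- With shape `2B²` and `A = B / m` the density is proportional to `x^(-3/2) exp(-A²x - B²/x)`, so
the tilt only shifts `A²` by `p` and `B²` by `c`. The parameter `p` yields the moment generating
function and `c` controls inverse moments. -/
lemma integral_exp_inverseGaussianMeasure {m A B p c : ℝ} (hm : 0 < m) (hB : 0 < B)
    (hA : A = B / m) (hp : p < A ^ 2) (hc : c < B ^ 2) :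
    Integrable (fun x => Real.exp (p * x + c / x)) (inverseGaussianMeasure m (2 * B ^ 2)) ∧
      ∫ x, Real.exp (p * x + c / x) ∂inverseGaussianMeasure m (2 * B ^ 2) =
        B / √(B ^ 2 - c) * Real.exp (2 * A * B - 2 * √(A ^ 2 - p) * √(B ^ 2 - c)) := by
  have hBc : 0 < √(B ^ 2 - c) := Real.sqrt_pos.mpr (by linarith)
  have hAp : 0 < √(A ^ 2 - p) := Real.sqrt_pos.mpr (by linarith)
  have hπ : 0 < √Real.pi := Real.sqrt_pos.mpr Real.pi_pos
  refine integrable_withDensity_and_integral (measurable_inverseGaussianPDFReal m (2 * B ^ 2))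
    (inverseGaussianPDFReal_nonneg m (2 * B ^ 2))
    (fun x hx => inverseGaussianPDFReal_of_neg m (2 * B ^ 2) hx) (by positivity) ?_
  have hJ := integral_inv_mul_sqrt_mul_exp hAp hBc
  rw [Real.sq_sqrt (by linarith), Real.sq_sqrt (by linarith)] at hJ
  have e : ∀ x ∈ Set.Ioi (0 : ℝ),
      inverseGaussianPDFReal m (2 * B ^ 2) x * Real.exp (p * x + c / x) =
      B / √Real.pi * Real.exp (2 * A * B) *
        ((x * √x)⁻¹ * Real.exp (-((A ^ 2 - p) * x) - (B ^ 2 - c) / x)) := by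
    intro x hx
    have hx : 0 < x := hx
    have hs : 0 < √x := Real.sqrt_pos.mpr hx
    have e1 : √(2 * B ^ 2 / (2 * Real.pi * x ^ 3)) = B / √Real.pi * (x * √x)⁻¹ := by
      have : 2 * B ^ 2 / (2 * Real.pi * x ^ 3) = (B / √Real.pi * (x * √x)⁻¹) ^ 2 := by
        rw [mul_pow, div_pow, inv_pow, mul_pow, Real.sq_sqrt hx.le,
          Real.sq_sqrt Real.pi_pos.le]
        have := Real.pi_pos
        field_simp
      rw [this, Real.sqrt_sq (by positivity)]
    have e2 : Real.exp (-(2 * B ^ 2 * (x - m) ^ 2) / (2 * m ^ 2 * x)) *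
        Real.exp (p * x + c / x) =
        Real.exp (2 * A * B) * Real.exp (-((A ^ 2 - p) * x) - (B ^ 2 - c) / x) := by
      rw [← Real.exp_add, ← Real.exp_add, hA]
      congr 1
      field_simp
      ring
    rw [inverseGaussianPDFReal, if_pos hx, e1, mul_assoc, e2]
    ring
  have e3 : Real.exp (2 * A * B - 2 * √(A ^ 2 - p) * √(B ^ 2 - c)) =
      Real.exp (2 * A * B) * Real.exp (-(2 * √(A ^ 2 - p) * √(B ^ 2 - c))) := by
    rw [← Real.exp_add, sub_eq_add_neg]
  rw [setIntegral_congr_fun measurableSet_Ioi e, integral_const_mul, hJ, e3]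
  field_simp

lemma isProbabilityMeasure_inverseGaussianMeasure {m lam : ℝ} (hm : 0 < m) (hl : 0 < lam) :
    IsProbabilityMeasure (inverseGaussianMeasure m lam) := by
  have hB : 0 < √(lam / 2) := by positivity
  have e : 2 * √(lam / 2) ^ 2 = lam := by rw [Real.sq_sqrt (by positivity)]; ring
  obtain ⟨h1, h2⟩ := integral_exp_inverseGaussianMeasure (p := 0) (c := 0) hm hB rfl
    (by positivity) (by positivity)
  rw [e] at h1 h2
  have hA : 0 ≤ √(lam / 2) / m := by positivity
  simp only [zero_mul, zero_div, add_zero, Real.exp_zero, sub_zero, Real.sqrt_sq hA,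
    Real.sqrt_sq hB.le, sub_self, mul_one, div_self hB.ne'] at h1 h2
  have hf : IsFiniteMeasure (inverseGaussianMeasure m lam) := by
    simpa [integrable_const_iff] using h1
  refine ⟨?_⟩
  rw [integral_const, smul_eq_mul, mul_one, measureReal_def] at h2
  rwa [ENNReal.toReal_eq_one_iff] at h2

lemma isConcentratedAtOne_inverseGaussian {η h : ℝ} (hη : 0 < η) (hh : 0 < h)
    (hε1 : η / h ≤ 1 / 36) :
    IsConcentratedAtOne (η / h) concentrationConst
      ((inverseGaussianMeasure h (h ^ 2 / η)).map fun v => v / h) := by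
  set ε := η / h with hεdef
  have hε : 0 < ε := by positivity
  have hmeas : Measurable fun v : ℝ => v / h := by fun_prop
  set B := √(h ^ 2 / η / 2) with hBdef
  have hB : 0 < B := by positivity
  have hB2 : B ^ 2 = h ^ 2 / η / 2 := Real.sq_sqrt (by positivity)
  have hlam : h ^ 2 / η = 2 * B ^ 2 := by rw [hB2]; ring
  set A := B / h with hAdef
  have hA : 0 < A := by positivity
  have hA2 : A ^ 2 = 1 / (2 * η) := by rw [hAdef, div_pow, hB2]; field_simp
  have hAB : 2 * A * B = 1 / ε := by
    rw [hAdef, show 2 * (B / h) * B = 2 * B ^ 2 / h by ring, hB2, hεdef]; field_simp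
  rw [hlam]
  have hpos : ∀ᵐ v ∂inverseGaussianMeasure h (2 * B ^ 2), 0 < v :=
    ae_pos_withDensity fun x hx => inverseGaussianPDFReal_of_neg _ _ hx
  have hst : ∀ s, 2 * ε * |s| < 1 → 0 < 1 - 2 * ε * s := fun s hs => by
    have h1 : 2 * ε * s ≤ 2 * ε * |s| :=
      mul_le_mul_of_nonneg_left (le_abs_self s) (by positivity)
    linarith
  have key : ∀ s, 2 * ε * |s| < 1 →
      Integrable (fun v => Real.exp (s * (v / h - 1))) (inverseGaussianMeasure h (2 * B ^ 2)) ∧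
      ∫ v, Real.exp (s * (v / h - 1)) ∂inverseGaussianMeasure h (2 * B ^ 2) =
        Real.exp ((1 - √(1 - 2 * ε * s)) / ε - s) := fun s hs => by
    have h1 := hst s hs
    have e1 : A ^ 2 - s / h = A ^ 2 * (1 - 2 * ε * s) := by
      rw [hA2, hεdef]; field_simp
    have h2 : s / h < A ^ 2 := by
      have : 0 < A ^ 2 * (1 - 2 * ε * s) := by positivity
      linarith
    obtain ⟨i1, i2⟩ := integral_exp_inverseGaussianMeasure (p := s / h) (c := 0) hh hB hAdef h2
      (by positivity)
    have e : ∀ v : ℝ, Real.exp (s * (v / h - 1)) =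
        Real.exp (-s) * Real.exp (s / h * v + 0 / v) := fun v => by
      rw [← Real.exp_add]; congr 1; ring
    simp only [e]
    refine ⟨i1.const_mul _, ?_⟩
    rw [integral_const_mul, i2, e1, sub_zero, Real.sqrt_sq hB.le, div_self hB.ne', one_mul,
      Real.sqrt_mul (sq_nonneg A), Real.sqrt_sq hA.le, ← Real.exp_add]
    congr 1
    have : 2 * A * B - 2 * (A * √(1 - 2 * ε * s)) * B
        = 2 * A * B * (1 - √(1 - 2 * ε * s)) := by ring
    rw [this, hAB]
    ring
  have hinv : Integrable (fun v : ℝ => (v / h)⁻¹ ^ 18) (inverseGaussianMeasure h (2 * B ^ 2)) ∧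
      ∫ v, (v / h)⁻¹ ^ 18 ∂inverseGaussianMeasure h (2 * B ^ 2) ≤ concentrationConst := by
    have h2ε : 1 / 2 ≤ 1 - 2 * ε := by linarith
    have e1 : B ^ 2 - h = B ^ 2 * (1 - 2 * ε) := by
      rw [hB2, hεdef]; field_simp
    have h1 : h < B ^ 2 := by
      have : 0 < B ^ 2 * (1 - 2 * ε) := by positivity
      linarith
    obtain ⟨i1, i2⟩ := integral_exp_inverseGaussianMeasure (p := 0) (c := h) hh hB hAdef
      (by positivity) h1
    have hb : ∀ᵐ v ∂inverseGaussianMeasure h (2 * B ^ 2), (v / h)⁻¹ ^ 18 ≤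
        (Nat.factorial 18 : ℝ) * Real.exp (0 * v + h / v) := by
      filter_upwards [hpos] with v hv
      have h3 := Real.pow_div_factorial_le_exp (h / v) (by positivity) 18
      rw [div_le_iff₀ (by positivity)] at h3
      rw [inv_div, zero_mul, zero_add]
      linarith
    have i3 := i1.const_mul (Nat.factorial 18 : ℝ)
    have i4 : Integrable (fun v : ℝ => (v / h)⁻¹ ^ 18) (inverseGaussianMeasure h (2 * B ^ 2)) := by
      refine i3.mono' (by fun_prop) ?_
      filter_upwards [hb] with v hv
      rwa [Real.norm_of_nonneg (by positivity)]
    refine ⟨i4, (integral_mono_ae i4 i3 hb).trans ?_⟩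
    have hsq : 1 - 2 * ε ≤ √(1 - 2 * ε) := by
      refine Real.le_sqrt_of_sq_le ?_
      nlinarith
    have hs0 : 0 < √(1 - 2 * ε) := by linarith
    have e2 : 2 * A * B - 2 * A * (B * √(1 - 2 * ε)) = 2 * A * B * (1 - √(1 - 2 * ε)) := by ring
    have e3 : 1 / ε * (1 - √(1 - 2 * ε)) ≤ 2 := by
      rw [one_div_mul_eq_div, div_le_iff₀ hε]; linarith
    have e4 : B / (B * √(1 - 2 * ε)) ≤ 2 := by
      rw [div_le_iff₀ (by positivity)]
      nlinarith
    have h5 := Real.exp_le_exp.mpr e3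
    rw [integral_const_mul, i2, e1, sub_zero, Real.sqrt_sq hA.le, Real.sqrt_mul (sq_nonneg B),
      Real.sqrt_sq hB.le, e2, hAB, concentrationConst, mul_comm 16]
    refine mul_le_mul_of_nonneg_left ?_ (by positivity)
    calc B / (B * √(1 - 2 * ε)) * Real.exp (1 / ε * (1 - √(1 - 2 * ε)))
        ≤ 2 * 8 := mul_le_mul e4 (h5.trans exp_two_le) (Real.exp_pos _).le (by norm_num)
      _ = 16 := by norm_num
  have dsqrt : ∀ s, 2 * ε * |s| < 1 → HasDerivAt (fun s => √(1 - 2 * ε * s))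
      (-ε / √(1 - 2 * ε * s)) s := fun s hs => by
    have d := (((hasDerivAt_id s).const_mul (2 * ε)).const_sub 1).sqrt (hst s hs).ne'
    convert! d using 1
    simp only [id]
    field_simp
  refine isConcentratedAtOne_of_mgf hε hε1
    (c := fun s => (1 - √(1 - 2 * ε * s)) / ε - s)
    (c₁ := fun s => (√(1 - 2 * ε * s))⁻¹ - 1) (c₂ := fun s => ε * (√(1 - 2 * ε * s) ^ 3)⁻¹)
    (c₃ := 3 * ε ^ 2) ?_ (fun s hs => ?_) (fun s hs => ?_) (fun s hs => ?_) (fun s hs => ?_)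
    ?_ (by simp) (by simp) (by simp) ?_ (fun s hs => ?_) ?_ ?_
  · rw [ae_map_iff hmeas.aemeasurable measurableSet_Ioi]
    filter_upwards [hpos] with v hv using div_pos hv hh
  · exact (integrable_map_measure (by fun_prop) hmeas.aemeasurable).mpr (key s hs).1
  · rw [integral_map hmeas.aemeasurable (by fun_prop)]
    exact (key s hs).2
  · have h1 := Real.sqrt_pos.mpr (hst s hs)
    have d := (((dsqrt s hs).const_sub 1).div_const ε).sub (hasDerivAt_id s)
    convert! d using 1
    field_simp
  · have h1 := Real.sqrt_pos.mpr (hst s hs)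
    have d := ((dsqrt s hs).fun_inv h1.ne').sub_const 1
    convert! d using 1
    field_simp
  · have h0 : 2 * ε * |(0 : ℝ)| < 1 := by simp
    have d := (((dsqrt 0 h0).fun_pow 3).fun_inv (by simp)).const_mul ε
    convert! d using 1
    simp
    ring
  · rw [abs_of_nonneg (by positivity)]
  · obtain ⟨hs1, hs2⟩ := abs_le.mp hs
    set u := ε * s with hu
    have h1 : 1 - u - u ^ 2 ≤ √(1 - 2 * ε * s) := by
      refine Real.le_sqrt_of_sq_le ?_
      rw [mul_assoc, ← hu]
      nlinarith [mul_nonneg (sq_nonneg u) (by nlinarith : 0 ≤ 1 - 2 * u - u ^ 2)]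
    have h2 : (1 - √(1 - 2 * ε * s)) / ε ≤ (u + u ^ 2) / ε :=
      div_le_div_of_nonneg_right (by linarith) hε.le
    have h3 : (u + u ^ 2) / ε = s + ε * s ^ 2 := by rw [hu]; field_simp
    have h4 : 0 ≤ ε * s ^ 2 := by positivity
    linarith
  · exact (integrable_map_measure (by fun_prop) hmeas.aemeasurable).mpr hinv.1
  · rw [integral_map hmeas.aemeasurable (by fun_prop)]
    exact hinv.2

lemma isProbabilityMeasure_mixingMeasure (k : NoiseKind) {η h : ℝ} (hη : 0 < η) (hh : 0 < h) :
    IsProbabilityMeasure (mixingMeasure k η h) := by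
  cases k with
  | nig => exact isProbabilityMeasure_inverseGaussianMeasure hh (by positivity)
  | gal => exact isProbabilityMeasure_gammaMeasure (by positivity) (by positivity)

lemma isConcentratedAtOne_mixingMeasure (k : NoiseKind) {η h : ℝ} (hη : 0 < η) (hh : 0 < h)
    (hε1 : η / h ≤ 1 / 36) :
    IsConcentratedAtOne (η / h) concentrationConst
      ((mixingMeasure k η h).map fun v => v / h) := by
  cases k with
  | nig => exact isConcentratedAtOne_inverseGaussian hη hh hε1
  | gal => exact isConcentratedAtOne_gamma hη hh hε1

instance isProbabilityMeasure_gaussianVectorMeasure {n : ℕ} (σ : ℝ) (h : Fin n → ℝ) :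
    IsProbabilityMeasure (gaussianVectorMeasure σ h) := by
  unfold gaussianVectorMeasure
  infer_instance

lemma isProbabilityMeasure_noiseMeasure (k : NoiseKind) (σ : ℝ) {η h : ℝ} (hη : 0 < η)
    (hh : 0 < h) : IsProbabilityMeasure (noiseMeasure k σ η 0 h) := by
  have := isProbabilityMeasure_mixingMeasure k hη hh
  have : IsProbabilityMeasure ((mixingMeasure k η h).map fun v => v / h) :=
    Measure.isProbabilityMeasure_map (by fun_prop)
  rw [noiseMeasure_zero_eq_map k σ η hh]
  exact Measure.isProbabilityMeasure_map (by fun_prop)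

/-- The expansion of the Kullback–Leibler divergence of a single symmetric noise variable from its
Gaussian limit. -/
lemma exists_klDiv_noiseMeasure_le : ∃ K : ℝ, ∀ (k : NoiseKind) (σ η h : ℝ), 0 < σ → 0 < η →
    0 < h → η / h ≤ 1 / 36 →
    InformationTheory.klDiv (noiseMeasure k σ η 0 h) (gaussianReal 0 (σ ^ 2 * h).toNNReal) ≠ ⊤ ∧
      |(InformationTheory.klDiv (noiseMeasure k σ η 0 h)
          (gaussianReal 0 (σ ^ 2 * h).toNNReal)).toReal
        - (3 / 16 * (η / h) ^ 2 - 9 / 16 * (η / h) ^ 3)| ≤ K * (η / h) ^ 4 := by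
  refine ⟨(258 * (3000000 * concentrationConst) ^ 4 + concentrationConst + 5) *
    ((1 + (Nat.factorial 16 : ℝ) * Real.exp 2 * concentrationConst) *
      ∫ y, (1 + y ^ 2) ^ 16 ∂gaussianReal 0 1), fun k σ η h hσ hη hh hε => ?_⟩
  have := isProbabilityMeasure_mixingMeasure k hη hh
  have : IsProbabilityMeasure ((mixingMeasure k η h).map fun v => v / h) :=
    Measure.isProbabilityMeasure_map (by fun_prop)
  rw [klDiv_noiseMeasure k hσ hh]
  exact (isConcentratedAtOne_mixingMeasure k hη hh hε).klDiv_varianceMixture (by positivity)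
    (by linarith)

end NoiseModel

theorem theorem4p1 (n : ℕ) (D : Matrix (Fin n) (Fin n) ℝ) (hD : D.det ≠ 0)
    (h : Fin n → ℝ) (hh : ∀ i, 0 < h i) (σ : ℝ) (hσ : 0 < σ)
    (k : Fin n → NoiseModel.NoiseKind)
    -- the flexible models (one law for each `η`, with `μ = 0`) and the base Gaussian model
    (P : ℝ → Measure (Fin n → ℝ)) (PB : Measure (Fin n → ℝ))
    (hP : ∀ η : ℝ, 0 < η →
      NoiseModel.IsSolutionLaw D (NoiseModel.noiseVectorMeasure k σ η 0 h) (P η))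
    (hPB : NoiseModel.IsSolutionLaw D (NoiseModel.gaussianVectorMeasure σ h) PB) :
    (∀ᶠ η in 𝓝[>] (0 : ℝ), InformationTheory.klDiv (P η) PB ≠ ⊤) ∧
    (fun η : ℝ => (InformationTheory.klDiv (P η) PB).toReal -
        ((3 / 16 : ℝ) * (∑ i, 1 / (h i) ^ 2) * η ^ 2
          - (9 / 16 : ℝ) * (∑ i, 1 / (h i) ^ 3) * η ^ 3))
      =O[𝓝[>] (0 : ℝ)] (fun η : ℝ => η ^ 4) := by
  obtain ⟨K, hK⟩ := NoiseModel.exists_klDiv_noiseMeasure_le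
  have hev : ∀ᶠ η in 𝓝[>] (0 : ℝ), 0 < η ∧ ∀ i, η / h i ≤ 1 / 36 := by
    refine Filter.Eventually.and self_mem_nhdsWithin (eventually_all.mpr fun i => ?_)
    have : Tendsto (fun η : ℝ => η / h i) (𝓝[>] 0) (𝓝 0) := by
      have h0 : Tendsto (fun η : ℝ => η / h i) (𝓝 0) (𝓝 (0 / h i)) :=
        tendsto_id.div_const (h i)
      rw [zero_div] at h0
      exact h0.mono_left nhdsWithin_le_nhds
    exact this.eventually_le_const (by norm_num)
  have hsum : ∀ η : ℝ, 0 < η → InformationTheory.klDiv (P η) PB =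
      ∑ i, InformationTheory.klDiv (NoiseModel.noiseMeasure (k i) σ η 0 (h i))
        (gaussianReal 0 (σ ^ 2 * h i).toNNReal) := fun η hη => by
    have := fun i => NoiseModel.isProbabilityMeasure_noiseMeasure (k i) σ hη (hh i)
    have : IsProbabilityMeasure (NoiseModel.noiseVectorMeasure k σ η 0 h) := by
      unfold NoiseModel.noiseVectorMeasure
      infer_instance
    rw [(hP η hη).klDiv_eq hD hPB]
    exact InformationTheory.klDiv_pi _ _
  constructor
  · filter_upwards [hev] with η ⟨hη, hε⟩
    rw [hsum η hη]
    exact ENNReal.sum_ne_top.mpr fun i _ => (hK (k i) σ η (h i) hσ hη (hh i) (hε i)).1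
  · refine IsBigO.of_bound (∑ i, K / h i ^ 4) ?_
    filter_upwards [hev] with η ⟨hη, hε⟩
    have hKi := fun i => hK (k i) σ η (h i) hσ hη (hh i) (hε i)
    rw [hsum η hη, ENNReal.toReal_sum fun i _ => (hKi i).1]
    have e : (3 / 16 : ℝ) * (∑ i, 1 / (h i) ^ 2) * η ^ 2
        - (9 / 16 : ℝ) * (∑ i, 1 / (h i) ^ 3) * η ^ 3 =
        ∑ i, (3 / 16 * (η / h i) ^ 2 - 9 / 16 * (η / h i) ^ 3) := by
      rw [Finset.sum_sub_distrib, Finset.mul_sum, Finset.mul_sum, Finset.sum_mul, Finset.sum_mul]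
      congr 1 <;> exact Finset.sum_congr rfl fun i _ => by rw [div_pow]; ring
    rw [e, ← Finset.sum_sub_distrib, Real.norm_eq_abs, Real.norm_of_nonneg (by positivity),
      Finset.sum_mul]
    refine (Finset.abs_sum_le_sum_abs _ _).trans (Finset.sum_le_sum fun i _ => ?_)
    refine (hKi i).2.trans (le_of_eq ?_)
    rw [div_pow]
    ring
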